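/- Let $d\ge 1$, let $K_d=\prod_{j=1}^d[a_j,b_j]\subset\mathbb R^d$ with $a_j\le b_j$, let $\|\cdot\|$ be the Euclidean norm and $B(x_0,r)=\{z\in\mathbb R^d:\|z-x_0\|\le r\}$. Let $(g_n)_{n\ge1}$ and $(W_n)_{n\ge1}$ be two independent sequences on a probability space such that * the $g_n$ are independent symmetric complex random variables (that is, $-g_n$ and $g_n$ have the same law) with $\mathbb E\big(e^{\operatorname{Re}(\bar z g_n)}\big)\le e^{|z|^2/2}$ for all $z\in\mathbb C$; * the $W_n$ are complex-valued random fields on $K_d$ with almost surely continuous sample paths, and for every $x\in K_d$, almost surely $\sum_{n\ge1}|W_n(x)|^2<\infty$. For $x,y\in K_d$ set $$S_N(x)=\sum_{n=1}^N W_n(x)g_n,\qquad S(x)=\lim_{N\to\infty}S_N(x),\qquad s(x,y)=\Big(\sum_{n\ge1}|W_n(x)-W_n(y)|^2\Big)^{1/2}\in[0,\infty].$$ Let $\rho:\mathbb R^d\times\mathbb R^d\to[0,\infty)$ be a quasi-metric, i.e. a continuous symmetric function with $\rho(x,y)=0$ iff $x=y$ and, for some $\kappa\ge1$, $\rho(x,z)\le\kappa(\rho(x,y)+\rho(y,z))$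 for all $x,y,z$. Suppose there are $0<\underline H\le\overline H\le1$ and $c_1,c_2\in(0,\infty)$ with $c_1\|x-y\|^{\overline H}\le\rho(x,y)\le c_2\|x-y\|^{\underline H}$ whenever $\|x-y\|\le1$. For $x_0\in K_d$, an event $\Omega'$ of probability one and random variables $\gamma>0$, $\beta\in(0,1]$, $\eta\in\mathbb R$, $C\in(0,\infty)$, say that *the local assumption holds at $x_0$ with $(\Omega',\gamma,\beta,\eta,C)$* if on $\Omega'$ $$s(x,y)\le C\,\rho(x,y)^\beta\,|\log\rho(x,y)|^\eta\quad\text{for all }x,y\in B(x_0,\gamma)\cap K_d\text{ with }\rho(x,y)\notin\{0,1\}.$$ For $A\subset K_d$, $\beta\in(0,1]$ and $\eta\in\mathbb R$, let $\mathcal H_\rho(A,\beta,\eta)$ be the set of functions $f:A\to\mathbb C$ for which there is $C\in(0,\infty)$ with $|f(x)-f(y)|\le C\rho(x,y)^\beta[\log(1+\rho(x,y)^{-1})]^\eta$ for all $x,y\in A$ (the right-hand side being read as $0$ if $x=y$). 1. Suppose that there are $\Omega'$, $\beta$ and $\eta$ such that for every $x_0\in K_d$ there are random variables $\gamma=\gamma_{x_0}$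 and $C=C_{x_0}$ for which the local assumption holds at $x_0$ with $(\Omega',\gamma,\beta,\eta,C)$. Then, with $A=K_d$: * almost surely there is $C\in(0,\infty)$ such that for all $x,y\in A$ $$\sup_{N\in\mathbb N}|S_N(x)-S_N(y)|\le C\,\rho(x,y)^\beta\,\big[\log\big(1+\rho(x,y)^{-1}\big)\big]^{\eta+1/2}$$ (the right-hand side being read as $0$ if $x=y$); * almost surely $S_N$ converges to $S$ uniformly on $A$; * almost surely $S\in\mathcal H_\rho(A,\beta,\eta+1/2)$, and in particular $S$ is continuous on $A$. 2. If $x_0\in K_d$ and the local assumption holds at $x_0$ with some $(\Omega',\gamma,\beta,\eta,C)$ in which $\gamma$ is deterministic, then the same three conclusions hold with $A=B(x_0,\gamma)\cap K_d$. -/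

import Mathlib

open MeasureTheory ProbabilityTheory Filter Topology
open scoped ENNReal NNReal

/-- The compact interval `∏ j, [a j, b j]` of `ℝ^d`, where `ℝ^d` carries the Euclidean norm. -/
def box {d : ℕ} (a b : Fin d → ℝ) : Set (EuclideanSpace ℝ (Fin d)) :=
  {x | ∀ j, x j ∈ Set.Icc (a j) (b j)}

/-- A complex random variable `Z` is sub-Gaussian with parameter `s` if
`E (exp (Re (conj z * Z))) ≤ exp (s² |z|² / 2)` for all `z`. The expectation of the nonnegative
variable is taken in `[0, ∞]`, so that its finiteness is part of the condition. -/
def IsSubGaussian {Ω : Type*} [MeasurableSpace Ω] (P : Measure Ω) (Z : Ω → ℂ) (s : ℝ≥0) : Prop :=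
  ∀ z : ℂ, ∫⁻ ω, ENNReal.ofReal (Real.exp ((starRingEnd ℂ z * Z ω).re)) ∂P
    ≤ ENNReal.ofReal (Real.exp ((s : ℝ) ^ 2 * ‖z‖ ^ 2 / 2))

/-- A complex random variable is symmetric if `-Z` and `Z` have the same law. -/
def IsSymmetricRV {Ω : Type*} [MeasurableSpace Ω] (P : Measure Ω) (Z : Ω → ℂ) : Prop :=
  IdentDistrib (fun ω => -Z ω) Z P P

/-- The standing assumption on the sequences `(g_n)` and `(W_n)`. Sequences indexed by `n ≥ 1` on
paper are indexed by `n : ℕ` here (a shift by one). The fields `W n` are indexed by points of `K`: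
their values outside `K` are never used. -/
structure CondSubGaussianSeq {Ω : Type*} [MeasurableSpace Ω] (P : Measure Ω) {d : ℕ}
    (K : Set (EuclideanSpace ℝ (Fin d)))
    (W : ℕ → EuclideanSpace ℝ (Fin d) → Ω → ℂ) (g : ℕ → Ω → ℂ) : Prop where
  measurable_g : ∀ n, Measurable (g n)
  indep_g : iIndepFun g P
  symm_g : ∀ n, IsSymmetricRV P (g n)
  subGaussian_g : ∀ n, IsSubGaussian P (g n) 1
  measurable_W : ∀ n, ∀ x ∈ K, Measurable (W n x)
  continuous_W : ∀ n, ∀ᵐ ω ∂P, ContinuousOn (fun x => W n x ω) K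
  summable_W : ∀ x ∈ K, ∀ᵐ ω ∂P, Summable (fun n => ‖W n x ω‖ ^ 2)
  /-- The sequence of fields `(W_n)` is independent of the sequence `(g_n)`. -/
  indep_W_g : IndepFun (fun ω (p : ℕ × K) => W p.1 p.2 ω) (fun ω (n : ℕ) => g n ω) P

/-- The partial sum `S_N(x)` of the first `N` terms of the series. -/
def partialSum {Ω : Type*} {d : ℕ} (W : ℕ → EuclideanSpace ℝ (Fin d) → Ω → ℂ) (g : ℕ → Ω → ℂ)
    (N : ℕ) (x : EuclideanSpace ℝ (Fin d)) (ω : Ω) : ℂ :=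
  ∑ n ∈ Finset.range N, W n x ω * g n ω

/-- The sum `S(x)` of the series, that is the limit of its partial sums (the series need not
converge absolutely). -/
noncomputable def seriesSum {Ω : Type*} {d : ℕ} (W : ℕ → EuclideanSpace ℝ (Fin d) → Ω → ℂ)
    (g : ℕ → Ω → ℂ) (x : EuclideanSpace ℝ (Fin d)) (ω : Ω) : ℂ :=
  limUnder atTop (fun N => partialSum W g N x ω)

/-- The conditional parameter `s(x, y) = (∑ |W_n(x) - W_n(y)|²)^{1/2}`, with values in `[0, ∞]`. -/
noncomputable def condParam {Ω : Type*} {d : ℕ} (W : ℕ → EuclideanSpace ℝ (Fin d) → Ω → ℂ)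
    (x y : EuclideanSpace ℝ (Fin d)) (ω : Ω) : ℝ≥0∞ :=
  (∑' n, ‖W n x ω - W n y ω‖ₑ ^ 2) ^ (1 / 2 : ℝ)

/-- Quasi-metrics on `ℝ^d`. -/
structure IsQuasiMetric {d : ℕ}
    (ρ : EuclideanSpace ℝ (Fin d) → EuclideanSpace ℝ (Fin d) → ℝ) : Prop where
  continuous : Continuous (fun p : EuclideanSpace ℝ (Fin d) × EuclideanSpace ℝ (Fin d) => ρ p.1 p.2)
  nonneg : ∀ x y, 0 ≤ ρ x y
  eq_zero_iff : ∀ x y, ρ x y = 0 ↔ x = y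
  symm : ∀ x y, ρ x y = ρ y x
  quasi_triangle : ∃ κ : ℝ, 1 ≤ κ ∧ ∀ x y z, ρ x z ≤ κ * (ρ x y + ρ y z)

/-- The two-sided local comparison of `ρ` with powers of the Euclidean distance. -/
def IsHolderComparable {d : ℕ}
    (ρ : EuclideanSpace ℝ (Fin d) → EuclideanSpace ℝ (Fin d) → ℝ) : Prop :=
  ∃ Hlow Hup c₁ c₂ : ℝ, 0 < Hlow ∧ Hlow ≤ Hup ∧ Hup ≤ 1 ∧ 0 < c₁ ∧ 0 < c₂ ∧
    ∀ x y, ‖x - y‖ ≤ 1 → c₁ * ‖x - y‖ ^ Hup ≤ ρ x y ∧ ρ x y ≤ c₂ * ‖x - y‖ ^ Hlow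

/-- The class `H_ρ(A, β, η)` of functions on `A` with uniform modulus of continuity
`ρ^β [log (1 + ρ⁻¹)]^η`. For `x = y` both sides of the inequality are `0` (as `β > 0`). -/
def MemAnisoHolder {d : ℕ} (ρ : EuclideanSpace ℝ (Fin d) → EuclideanSpace ℝ (Fin d) → ℝ)
    (A : Set (EuclideanSpace ℝ (Fin d))) (β η : ℝ) (f : EuclideanSpace ℝ (Fin d) → ℂ) : Prop :=
  ∃ C : ℝ, 0 < C ∧ ∀ x ∈ A, ∀ y ∈ A,
    ‖f x - f y‖ ≤ C * ρ x y ^ β * Real.log (1 + (ρ x y)⁻¹) ^ η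

/-- The local assumption at `x₀` with almost sure event `Ω'` and random variables `γ, β, η, C`:
on `Ω'`, `s(x, y) ≤ C ρ(x, y)^β |log ρ(x, y)|^η` on `B(x₀, γ) ∩ K`, with `B` the closed Euclidean
ball. The inequality is trivial for `ρ(x, y) = 0`, that is `x = y`; it is not required where
`ρ(x, y) = 1`, since `log ρ(x, y)` vanishes there. -/
structure LocalAssumption {Ω : Type*} [MeasurableSpace Ω] (P : Measure Ω) {d : ℕ}
    (K : Set (EuclideanSpace ℝ (Fin d))) (W : ℕ → EuclideanSpace ℝ (Fin d) → Ω → ℂ)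
    (ρ : EuclideanSpace ℝ (Fin d) → EuclideanSpace ℝ (Fin d) → ℝ)
    (x₀ : EuclideanSpace ℝ (Fin d)) (Ω' : Set Ω) (γ β η C : Ω → ℝ) : Prop where
  measurableSet_event : MeasurableSet Ω'
  event_as : P Ω' = 1
  measurable_γ : Measurable γ
  measurable_β : Measurable β
  measurable_η : Measurable η
  measurable_C : Measurable C
  γ_pos : ∀ ω, 0 < γ ω
  β_mem : ∀ ω, β ω ∈ Set.Ioc (0 : ℝ) 1
  C_pos : ∀ ω, 0 < C ω
  bound : ∀ ω ∈ Ω', ∀ x ∈ Metric.closedBall x₀ (γ ω) ∩ K, ∀ y ∈ Metric.closedBall x₀ (γ ω) ∩ K,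
    ρ x y ≠ 0 → ρ x y ≠ 1 →
      condParam W x y ω ≤ ENNReal.ofReal (C ω * ρ x y ^ β ω * |Real.log (ρ x y)| ^ η ω)

/-- The conclusion on a deterministic set `A`: almost surely, the partial sums satisfy a bound on
their modulus of continuity on `A` that is uniform in `N`, they converge uniformly on `A` to `S`,
and `S` belongs to `H_ρ(A, β, η + 1/2)` and is continuous on `A`. -/
def UniformRegularityOn {Ω : Type*} [MeasurableSpace Ω] (P : Measure Ω) {d : ℕ}
    (W : ℕ → EuclideanSpace ℝ (Fin d) → Ω → ℂ) (g : ℕ → Ω → ℂ)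
    (ρ : EuclideanSpace ℝ (Fin d) → EuclideanSpace ℝ (Fin d) → ℝ)
    (A : Set (EuclideanSpace ℝ (Fin d))) (β η : Ω → ℝ) : Prop :=
  (∀ᵐ ω ∂P, ∃ C : ℝ, 0 < C ∧ ∀ x ∈ A, ∀ y ∈ A, ∀ N : ℕ,
    ‖partialSum W g N x ω - partialSum W g N y ω‖
      ≤ C * ρ x y ^ β ω * Real.log (1 + (ρ x y)⁻¹) ^ (η ω + 1 / 2)) ∧
  (∀ᵐ ω ∂P, TendstoUniformlyOn (fun N x => partialSum W g N x ω)
    (fun x => seriesSum W g x ω) atTop A) ∧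
  (∀ᵐ ω ∂P, MemAnisoHolder ρ A (β ω) (η ω + 1 / 2) (fun x => seriesSum W g x ω)) ∧
  (∀ᵐ ω ∂P, ContinuousOn (fun x => seriesSum W g x ω) A)

/-! Conditionally on `W`, each increment of the series is a sub-Gaussian series with deterministic
coefficients and parameter `s(x, y)`. An exponential supermartingale and Ville's inequality bound
the supremum over `N` of its partial sums: it exceeds `2 t s(x, y)` with probability at most `4 exp
(-t² / 2)` (`measure_exists_lt_norm_sum_le`). Fubini carries this over to random coefficients.

On nets of `ρ`-mesh about `exp (-k)` there are only `exp (O(k))` pairs of points. Taking `t` of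
order `√k` and applying Borel–Cantelli, almost surely all net increments of level `k` are at most a
constant times `√k · s` for large `k` (`ae_eventually_increments_le`). Since `k` is about `|log ρ|`,
this `√k` is the extra `1/2` in the logarithmic exponent.

The rest is deterministic, for a fixed `ω`. The local assumption bounds `√k · s` at scale `exp (-k)`
by `exp (-β k) k ^ (η + 1/2)`, whose tails sum to the order of the first term, so chaining along the
nets controls all increments uniformly in `N` (`exists_chaining_bound`). Convergence at the net
points then becomes uniform convergence on the compact set, and the modulus passes to the limit. As
the probabilistic estimates do not involve `β`, `η`, `γ`, `C`, these may be random; compactness is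
applied for each `ω` to pass from local bounds to a bound at small distances
(`exists_forall_le_of_local`). -/

/-! ### Maximal inequalities for sub-Gaussian series. -/

/-- The partial products of `ξ`, frozen as soon as they reach the level `c`. -/
noncomputable def stoppedProd {Ω : Type*} (c : ℝ≥0∞) (ξ : ℕ → Ω → ℝ≥0∞) : ℕ → Ω → ℝ≥0∞
  | 0 => fun _ => 1
  | n + 1 => fun ω =>
      if c ≤ stoppedProd c ξ n ω then stoppedProd c ξ n ω else stoppedProd c ξ n ω * ξ n ω

theorem le_stoppedProd_or_eq {Ω : Type*} (c : ℝ≥0∞) (ξ : ℕ → Ω → ℝ≥0∞) (n : ℕ) (ω : Ω) :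
    c ≤ stoppedProd c ξ n ω ∨ stoppedProd c ξ n ω = ∏ i ∈ Finset.range n, ξ i ω := by
  induction n with
  | zero => right; simp [stoppedProd]
  | succ n ih =>
    by_cases h : c ≤ stoppedProd c ξ n ω
    · left; simp [stoppedProd, h]
    · right
      rcases ih with ih | ih
      · exact absurd ih h
      · rw [Finset.prod_range_succ, ← ih]
        exact if_neg h

/-- Freezing makes reaching the level permanent, so the event "reached at some time" is an
increasing union, to which Markov's inequality applies at each fixed time. -/
theorem stoppedProd_mono_level {Ω : Type*} (c : ℝ≥0∞) (ξ : ℕ → Ω → ℝ≥0∞) :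
    Monotone fun n => {ω | c ≤ stoppedProd c ξ n ω} := by
  refine monotone_nat_of_le_succ fun n ω h => ?_
  have h' : c ≤ stoppedProd c ξ n ω := h
  simp [stoppedProd, h']

theorem measurable_stoppedProd {Ω : Type*} {m : MeasurableSpace Ω} (c : ℝ≥0∞)
    {ξ : ℕ → Ω → ℝ≥0∞} (n : ℕ) (h : ∀ i < n, Measurable[m] (ξ i)) :
    Measurable[m] (stoppedProd c ξ n) := by
  induction n with
  | zero => exact measurable_const
  | succ n ih =>
    have h' := ih fun i hi => h i (by omega)
    exact Measurable.ite (measurableSet_le measurable_const h') h' (h'.mul (h n (by omega)))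

/-- Supermartingale property: where the level has been reached nothing changes; elsewhere the
product is multiplied by an independent factor of mean at most one. -/
theorem lintegral_stoppedProd_le_one {Ω : Type*} [MeasurableSpace Ω] {P : Measure Ω}
    [IsProbabilityMeasure P] (c : ℝ≥0∞) {ξ : ℕ → Ω → ℝ≥0∞} (hm : ∀ n, Measurable (ξ n))
    (hi : iIndepFun ξ P) (h1 : ∀ n, ∫⁻ ω, ξ n ω ∂P ≤ 1) (n : ℕ) :
    ∫⁻ ω, stoppedProd c ξ n ω ∂P ≤ 1 := by
  induction n with
  | zero => simp [stoppedProd]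
  | succ n ih =>
    have hT := measurable_stoppedProd c n fun i _ => hm i
    set B : Set Ω := {ω | c ≤ stoppedProd c ξ n ω} with hB
    have hBm : MeasurableSet B := measurableSet_le measurable_const hT
    have hsplit : ∀ ω, stoppedProd c ξ (n + 1) ω
        = B.indicator (stoppedProd c ξ n) ω + Bᶜ.indicator (stoppedProd c ξ n) ω * ξ n ω := by
      intro ω
      by_cases h : ω ∈ B
      · have h' : c ≤ stoppedProd c ξ n ω := h
        simp [stoppedProd, h, h']
      · have h' : ¬ c ≤ stoppedProd c ξ n ω := h
        simp [stoppedProd, h, h']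
    have hind : IndepFun (Bᶜ.indicator (stoppedProd c ξ n)) (ξ n) P := by
      have hI : Indep (⨆ i ∈ Set.Iio n, MeasurableSpace.comap (ξ i) inferInstance)
          (⨆ i ∈ ({n} : Set ℕ), MeasurableSpace.comap (ξ i) inferInstance) P :=
        indep_iSup_of_disjoint (fun i => (hm i).comap_le) hi (by simp)
      have hTm : Measurable[⨆ i ∈ Set.Iio n, MeasurableSpace.comap (ξ i) inferInstance]
          (stoppedProd c ξ n) := by
        refine measurable_stoppedProd c n fun i hi => ?_
        exact (comap_measurable (ξ i)).mono
          (le_iSup₂_of_le (f := fun i (_ : i ∈ Set.Iio n) =>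
            MeasurableSpace.comap (ξ i) inferInstance) i hi le_rfl) le_rfl
      have hTi : Measurable[⨆ i ∈ Set.Iio n, MeasurableSpace.comap (ξ i) inferInstance]
          (Bᶜ.indicator (stoppedProd c ξ n)) :=
        hTm.indicator (measurableSet_le measurable_const hTm).compl
      refine indep_of_indep_of_le_right (indep_of_indep_of_le_left hI hTi.comap_le) ?_
      simp
    calc ∫⁻ ω, stoppedProd c ξ (n + 1) ω ∂P
        = ∫⁻ ω, B.indicator (stoppedProd c ξ n) ω ∂P
          + ∫⁻ ω, Bᶜ.indicator (stoppedProd c ξ n) ω * ξ n ω ∂P := by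
          simp_rw [hsplit]
          rw [lintegral_add_left (hT.indicator hBm)]
      _ = ∫⁻ ω, B.indicator (stoppedProd c ξ n) ω ∂P
          + (∫⁻ ω, Bᶜ.indicator (stoppedProd c ξ n) ω ∂P) * ∫⁻ ω, ξ n ω ∂P := by
          congr 1
          exact lintegral_mul_eq_lintegral_mul_lintegral_of_indepFun
            (hT.indicator hBm.compl) (hm n) hind
      _ ≤ ∫⁻ ω, B.indicator (stoppedProd c ξ n) ω ∂P
          + (∫⁻ ω, Bᶜ.indicator (stoppedProd c ξ n) ω ∂P) * 1 := by
          gcongr; exact h1 n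
      _ = ∫⁻ ω, stoppedProd c ξ n ω ∂P := by
          rw [mul_one, lintegral_indicator hBm, lintegral_indicator hBm.compl,
            lintegral_add_compl _ hBm]
      _ ≤ 1 := ih

/-- Ville's maximal inequality for products of independent nonnegative variables of mean at most
one. -/
theorem mul_measure_exists_le_prod_le_one {Ω : Type*} [MeasurableSpace Ω] {P : Measure Ω}
    [IsProbabilityMeasure P] (c : ℝ≥0∞) {ξ : ℕ → Ω → ℝ≥0∞} (hm : ∀ n, Measurable (ξ n))
    (hi : iIndepFun ξ P) (h1 : ∀ n, ∫⁻ ω, ξ n ω ∂P ≤ 1) :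
    c * P {ω | ∃ N, c ≤ ∏ n ∈ Finset.range N, ξ n ω} ≤ 1 := by
  have hsub : {ω | ∃ N, c ≤ ∏ n ∈ Finset.range N, ξ n ω}
      ⊆ ⋃ n, {ω | c ≤ stoppedProd c ξ n ω} := by
    rintro ω ⟨N, hN⟩
    refine Set.mem_iUnion.2 ⟨N, ?_⟩
    rcases le_stoppedProd_or_eq c ξ N ω with h | h
    · exact h
    · simpa [h] using hN
  calc c * P {ω | ∃ N, c ≤ ∏ n ∈ Finset.range N, ξ n ω}
      ≤ c * P (⋃ n, {ω | c ≤ stoppedProd c ξ n ω}) := by gcongr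
    _ = ⨆ n, c * P {ω | c ≤ stoppedProd c ξ n ω} := by
        rw [(stoppedProd_mono_level c ξ).measure_iUnion, ENNReal.mul_iSup]
    _ ≤ 1 := iSup_le fun n =>
        (mul_meas_ge_le_lintegral (measurable_stoppedProd c n fun i _ => hm i) c).trans
          (lintegral_stoppedProd_le_one c hm hi h1 n)

/-- One-sided maximal inequality for sub-Gaussian series with deterministic coefficients, in the
direction `z`. -/
theorem measure_exists_lt_re_sum_le {Ω : Type*} [MeasurableSpace Ω] {P : Measure Ω}
    [IsProbabilityMeasure P] {g : ℕ → Ω → ℂ} (hm : ∀ n, Measurable (g n)) (hi : iIndepFun g P)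
    (hg : ∀ n, IsSubGaussian P (g n) 1) (x : ℕ → ℂ) (z : ℂ) (t : ℝ)
    (hx : ∀ N, ‖z‖ ^ 2 * ∑ n ∈ Finset.range N, ‖x n‖ ^ 2 ≤ t ^ 2) :
    P {ω | ∃ N, t ^ 2 < ((starRingEnd ℂ z) * ∑ n ∈ Finset.range N, x n * g n ω).re}
      ≤ ENNReal.ofReal (Real.exp (-(t ^ 2 / 2))) := by
  -- Exponential factors normalised to have mean at most one, by the sub-Gaussian bound at `z * conj
  -- (x n)`. If the linear part exceeds `t²`, the compensator, at most `t² / 2`, leaves a product of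
  -- at least `exp (t² / 2)`.
  set ξ : ℕ → Ω → ℝ≥0∞ := fun n ω => ENNReal.ofReal
    (Real.exp ((starRingEnd ℂ z * (x n * g n ω)).re - ‖z‖ ^ 2 * ‖x n‖ ^ 2 / 2)) with hξ
  have hξm : ∀ n, Measurable (ξ n) := by
    intro n
    have := hm n
    fun_prop
  have hξi : iIndepFun ξ P := by
    refine hi.comp (fun n w => ENNReal.ofReal
      (Real.exp ((starRingEnd ℂ z * (x n * w)).re - ‖z‖ ^ 2 * ‖x n‖ ^ 2 / 2))) fun n => ?_
    fun_prop
  have hξ1 : ∀ n, ∫⁻ ω, ξ n ω ∂P ≤ 1 := by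
    intro n
    have h := hg n (z * starRingEnd ℂ (x n))
    have e : ∀ ω, ξ n ω = ENNReal.ofReal (Real.exp (-(‖z‖ ^ 2 * ‖x n‖ ^ 2 / 2))) *
        ENNReal.ofReal (Real.exp ((starRingEnd ℂ (z * starRingEnd ℂ (x n)) * g n ω).re)) := by
      intro ω
      rw [← ENNReal.ofReal_mul (Real.exp_pos _).le, ← Real.exp_add, hξ]
      simp only [map_mul, Complex.conj_conj, mul_assoc]
      congr 2
      ring
    simp_rw [e]
    rw [lintegral_const_mul' _ _ ENNReal.ofReal_ne_top]
    refine (mul_le_mul_right h _).trans ?_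
    rw [← ENNReal.ofReal_mul (Real.exp_pos _).le, ← Real.exp_add]
    rw [show -(‖z‖ ^ 2 * ‖x n‖ ^ 2 / 2)
      + ((1 : ℝ≥0) : ℝ) ^ 2 * ‖z * starRingEnd ℂ (x n)‖ ^ 2 / 2 = 0 by
        simp only [norm_mul, RCLike.norm_conj, NNReal.coe_one]; ring]
    simp
  have hprod : ∀ N ω, ∏ n ∈ Finset.range N, ξ n ω = ENNReal.ofReal (Real.exp
      ((starRingEnd ℂ z * ∑ n ∈ Finset.range N, x n * g n ω).re
        - ‖z‖ ^ 2 * (∑ n ∈ Finset.range N, ‖x n‖ ^ 2) / 2)) := by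
    intro N ω
    rw [hξ, ← ENNReal.ofReal_prod_of_nonneg fun _ _ => (Real.exp_pos _).le, ← Real.exp_sum,
      Finset.sum_sub_distrib, Finset.mul_sum, Complex.re_sum, ← Finset.sum_div, Finset.mul_sum]
  have hV := mul_measure_exists_le_prod_le_one (ENNReal.ofReal (Real.exp (t ^ 2 / 2))) hξm hξi hξ1
  rw [Real.exp_neg, ENNReal.ofReal_inv_of_pos (Real.exp_pos _), ENNReal.le_inv_iff_mul_le, mul_comm]
  refine (mul_le_mul_right (measure_mono ?_) _).trans hV
  rintro ω ⟨N, hN⟩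
  refine ⟨N, ?_⟩
  rw [hprod]
  refine ENNReal.ofReal_le_ofReal (Real.exp_le_exp.2 ?_)
  linarith [hx N]

/-- Maximal inequality for sub-Gaussian series with deterministic coefficients. -/
theorem measure_exists_lt_norm_sum_le {Ω : Type*} [MeasurableSpace Ω] {P : Measure Ω}
    [IsProbabilityMeasure P] {g : ℕ → Ω → ℂ} (hm : ∀ n, Measurable (g n)) (hi : iIndepFun g P)
    (hg : ∀ n, IsSubGaussian P (g n) 1) (x : ℕ → ℂ) {t : ℝ} (ht : 0 < t) :
    P {ω | ∃ N, ENNReal.ofReal (2 * t) * (∑' n, ‖x n‖ₑ ^ 2) ^ (1 / 2 : ℝ)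
        < ‖∑ n ∈ Finset.range N, x n * g n ω‖ₑ}
      ≤ 4 * ENNReal.ofReal (Real.exp (-(t ^ 2 / 2))) := by
  set σ : ℝ≥0∞ := (∑' n, ‖x n‖ₑ ^ 2) ^ (1 / 2 : ℝ) with hσ
  by_cases htop : σ = ⊤
  · have : {ω | ∃ N, ENNReal.ofReal (2 * t) * σ < ‖∑ n ∈ Finset.range N, x n * g n ω‖ₑ} = ∅ := by
      ext ω
      simp [htop, ENNReal.mul_top, ht]
    rw [this]; simp
  by_cases hzero : σ = 0
  · have hx : ∀ n, x n = 0 := by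
      have h0 : ∑' n, ‖x n‖ₑ ^ 2 = 0 := by
        by_contra h
        have := (ENNReal.rpow_eq_zero_iff.1 hzero)
        rcases this with h' | h'
        · exact h h'.1
        · norm_num at h'
      intro n
      have := ENNReal.tsum_eq_zero.1 h0 n
      simpa using this
    simp [hx]
  set s : ℝ := σ.toReal with hs
  have hs0 : 0 < s := ENNReal.toReal_pos hzero htop
  have hσs : σ = ENNReal.ofReal s := (ENNReal.ofReal_toReal htop).symm
  have hsum : ∀ N, ∑ n ∈ Finset.range N, ‖x n‖ ^ 2 ≤ s ^ 2 := by
    intro N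
    have h1 : σ ^ 2 = ∑' n, ‖x n‖ₑ ^ 2 := by
      rw [hσ, ← ENNReal.rpow_natCast, ← ENNReal.rpow_mul]; norm_num
    have h2 : ENNReal.ofReal (∑ n ∈ Finset.range N, ‖x n‖ ^ 2) ≤ ENNReal.ofReal (s ^ 2) := by
      rw [ENNReal.ofReal_pow hs0.le, ← hσs, h1, ENNReal.ofReal_sum_of_nonneg fun _ _ => by positivity]
      refine le_trans (le_of_eq ?_) (ENNReal.sum_le_tsum (Finset.range N))
      refine Finset.sum_congr rfl fun n _ => ?_
      rw [ENNReal.ofReal_pow (norm_nonneg _), ofReal_norm]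
    exact (ENNReal.ofReal_le_ofReal_iff (by positivity)).1 h2
  have key : ∀ u : ℂ, ‖u‖ = 1 →
      P {ω | ∃ N, t ^ 2 < ((starRingEnd ℂ (((t / s : ℝ) : ℂ) * u))
        * ∑ n ∈ Finset.range N, x n * g n ω).re}
        ≤ ENNReal.ofReal (Real.exp (-(t ^ 2 / 2))) := by
    intro u hu
    refine measure_exists_lt_re_sum_le hm hi hg x _ t fun N => ?_
    rw [norm_mul, hu, mul_one, Complex.norm_real, Real.norm_eq_abs, sq_abs, div_pow, div_mul_eq_mul_div,
      div_le_iff₀ (by positivity)]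
    exact mul_le_mul_of_nonneg_left (hsum N) (sq_nonneg t)
  -- A norm above `2 t s` forces the real or imaginary part above `t s` in absolute value, hence one
  -- of the four directions `±1`, `±I`. The length `t / s` of `z` is what makes `‖z‖² s² = t²`.
  set B : ℂ → Set Ω := fun u => {ω | ∃ N, t ^ 2 < ((starRingEnd ℂ (((t / s : ℝ) : ℂ) * u))
        * ∑ n ∈ Finset.range N, x n * g n ω).re} with hB
  have hsub : {ω | ∃ N, ENNReal.ofReal (2 * t) * σ < ‖∑ n ∈ Finset.range N, x n * g n ω‖ₑ}
      ⊆ (B 1 ∪ B (-1)) ∪ (B Complex.I ∪ B (-Complex.I)) := by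
    rintro ω ⟨N, hN⟩
    set w := ∑ n ∈ Finset.range N, x n * g n ω with hw
    rw [hσs, ← ENNReal.ofReal_mul (by positivity), ← ofReal_norm,
      ENNReal.ofReal_lt_ofReal_iff_of_nonneg (by positivity)] at hN
    have hN' : 2 * t * s < |w.re| + |w.im| := hN.trans_le (Complex.norm_le_abs_re_add_abs_im w)
    have aux : ∀ v : ℝ, t * s < v → t ^ 2 < t / s * v := by
      intro v hv
      rw [div_mul_eq_mul_div, lt_div_iff₀ hs0]
      nlinarith
    have hcase : t * s < |w.re| ∨ t * s < |w.im| := by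
      by_contra! h
      linarith [h.1, h.2]
    rcases hcase with h | h
    · left
      rcases lt_abs.1 h with h | h
      · left; refine ⟨N, ?_⟩; rw [← hw]; simpa using aux _ h
      · right; refine ⟨N, ?_⟩; rw [← hw]; simpa using aux _ h
    · right
      rcases lt_abs.1 h with h | h
      · left; refine ⟨N, ?_⟩; rw [← hw]; simpa using aux _ h
      · right; refine ⟨N, ?_⟩; rw [← hw]; simpa using aux _ h
  refine (measure_mono hsub).trans ((measure_union_le _ _).trans ?_)
  refine (add_le_add (measure_union_le _ _) (measure_union_le _ _)).trans ?_
  refine (add_le_add (add_le_add (key 1 (by simp)) (key (-1) (by simp)))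
    (add_le_add (key Complex.I (by simp)) (key (-Complex.I) (by simp)))).trans (le_of_eq ?_)
  ring

/-- Maximal inequality for sub-Gaussian series with random coefficients, independent of the
sub-Gaussian variables. -/
theorem measure_exists_lt_norm_sum_le_of_indepFun {Ω : Type*} [MeasurableSpace Ω] {P : Measure Ω}
    [IsProbabilityMeasure P] {g : ℕ → Ω → ℂ} (hm : ∀ n, Measurable (g n)) (hi : iIndepFun g P)
    (hg : ∀ n, IsSubGaussian P (g n) 1) {X : ℕ → Ω → ℂ} (hX : ∀ n, Measurable (X n))
    (hXg : IndepFun (fun ω n => X n ω) (fun ω n => g n ω) P) {t : ℝ} (ht : 0 < t) :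
    P {ω | ∃ N, ENNReal.ofReal (2 * t) * (∑' n, ‖X n ω‖ₑ ^ 2) ^ (1 / 2 : ℝ)
        < ‖∑ n ∈ Finset.range N, X n ω * g n ω‖ₑ}
      ≤ 4 * ENNReal.ofReal (Real.exp (-(t ^ 2 / 2))) := by
  have hXm : Measurable (fun ω n => X n ω) := measurable_pi_lambda _ hX
  have hGm : Measurable (fun ω n => g n ω) := measurable_pi_lambda _ hm
  -- By independence the joint law is a product, so the bound for deterministic coefficients can be
  -- integrated over the law of `X`.
  set E : Set ((ℕ → ℂ) × (ℕ → ℂ)) := {p | ∃ N, ENNReal.ofReal (2 * t) *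
    (∑' n, ‖p.1 n‖ₑ ^ 2) ^ (1 / 2 : ℝ) < ‖∑ n ∈ Finset.range N, p.1 n * p.2 n‖ₑ} with hE
  have hEm : MeasurableSet E := by
    rw [hE, Set.ofPred_exists]
    refine MeasurableSet.iUnion fun N => measurableSet_lt ?_ ?_
    · refine Measurable.const_mul (Measurable.pow_const ?_ _) _
      exact Measurable.tsum fun n => by fun_prop
    · fun_prop
  have hmap := (indepFun_iff_map_prod_eq_prod_map_map hXm.aemeasurable hGm.aemeasurable).1 hXg
  have := Measure.isProbabilityMeasure_map (μ := P) hXm.aemeasurable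
  have := Measure.isProbabilityMeasure_map (μ := P) hGm.aemeasurable
  calc P _ = P ((fun ω => ((fun n => X n ω), (fun n => g n ω))) ⁻¹' E) := rfl
    _ = (P.map (fun ω => ((fun n => X n ω), (fun n => g n ω)))) E :=
        (Measure.map_apply (hXm.prodMk hGm) hEm).symm
    _ = ∫⁻ x, (P.map (fun ω n => g n ω)) (Prod.mk x ⁻¹' E) ∂(P.map (fun ω n => X n ω)) := by
        rw [hmap, Measure.prod_apply hEm]
    _ ≤ ∫⁻ _, 4 * ENNReal.ofReal (Real.exp (-(t ^ 2 / 2))) ∂(P.map (fun ω n => X n ω)) := by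
        refine lintegral_mono fun x => ?_
        rw [Measure.map_apply hGm (measurable_prodMk_left hEm)]
        exact measure_exists_lt_norm_sum_le hm hi hg x ht
    _ = 4 * ENNReal.ofReal (Real.exp (-(t ^ 2 / 2))) := by simp

/-! ### Pointwise almost sure convergence. -/

/-- A sub-Gaussian series with random square-summable coefficients, independent of the
sub-Gaussian variables, converges almost surely. -/
theorem ae_cauchySeq_sum_of_indepFun {Ω : Type*} [MeasurableSpace Ω] {P : Measure Ω}
    [IsProbabilityMeasure P] {g : ℕ → Ω → ℂ} (hm : ∀ n, Measurable (g n)) (hi : iIndepFun g P)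
    (hg : ∀ n, IsSubGaussian P (g n) 1) {X : ℕ → Ω → ℂ} (hX : ∀ n, Measurable (X n))
    (hXg : IndepFun (fun ω n => X n ω) (fun ω n => g n ω) P)
    (hs : ∀ᵐ ω ∂P, Summable fun n => ‖X n ω‖ ^ 2) :
    ∀ᵐ ω ∂P, CauchySeq fun N => ∑ n ∈ Finset.range N, X n ω * g n ω := by
  set τ : ℕ → Ω → ℝ≥0∞ := fun m ω => (∑' n, ‖X (n + m) ω‖ₑ ^ 2) ^ (1 / 2 : ℝ) with hτ
  set E : ℝ → ℕ → Set Ω := fun t m => {ω | ∃ N, ENNReal.ofReal (2 * t) * τ m ω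
    < ‖∑ n ∈ Finset.range N, X (n + m) ω * g (n + m) ω‖ₑ} with hE
  have hEP : ∀ t : ℝ, 0 < t → ∀ m, P (E t m) ≤ 4 * ENNReal.ofReal (Real.exp (-(t ^ 2 / 2))) := by
    intro t ht m
    refine measure_exists_lt_norm_sum_le_of_indepFun (fun n => hm (n + m))
      (hi.precomp (g := fun n => n + m) (add_left_injective m)) (fun n => hg (n + m))
      (fun n => hX (n + m)) ?_ ht
    exact hXg.comp (φ := fun (x : ℕ → ℂ) n => x (n + m)) (ψ := fun (x : ℕ → ℂ) n => x (n + m))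
      (by fun_prop) (by fun_prop)
  -- `L t` is the lower limit of the `E t m`, so its probability obeys their common bound, which
  -- vanishes as `t → ∞`. Hence almost surely, for some `t`, infinitely many `m` lie outside the bad
  -- events: every partial sum of the tail from `m` is at most a fixed multiple of `τ m`. As `τ m →
  -- 0`, one such `m` for each `ε` proves the Cauchy property.
  set L : ℝ → Set Ω := fun t => ⋃ M, ⋂ m ≥ M, E t m with hL
  have hLP : ∀ t : ℝ, 0 < t → P (L t) ≤ 4 * ENNReal.ofReal (Real.exp (-(t ^ 2 / 2))) := by
    intro t ht
    have hmono : Monotone fun M => ⋂ m ≥ M, E t m := fun M M' h =>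
      Set.biInter_subset_biInter_left fun m hm => le_trans h hm
    rw [hL, hmono.measure_iUnion]
    exact iSup_le fun M => (measure_mono (Set.biInter_subset_of_mem (le_refl M))).trans (hEP t ht M)
  have hnull : P (⋂ t : ℕ, L (t + 1)) = 0 := by
    have hlim : Tendsto (fun t : ℕ => 4 * ENNReal.ofReal (Real.exp (-(((t : ℝ) + 1) ^ 2 / 2))))
        atTop (𝓝 (4 * 0)) := by
      refine ENNReal.Tendsto.const_mul ?_ (Or.inr (by simp))
      rw [← ENNReal.ofReal_zero]
      refine ENNReal.tendsto_ofReal (Real.tendsto_exp_neg_atTop_nhds_zero.comp ?_)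
      refine tendsto_atTop_mono (f := fun t : ℕ => (t : ℝ) / 2) (fun t => ?_)
        (tendsto_natCast_atTop_atTop.atTop_div_const two_pos)
      nlinarith [(Nat.cast_nonneg t : (0 : ℝ) ≤ t)]
    rw [mul_zero] at hlim
    refine le_antisymm (ge_of_tendsto' hlim fun t => ?_) zero_le
    exact (measure_mono (Set.iInter_subset _ t)).trans (hLP _ (by positivity))
  filter_upwards [hs, measure_eq_zero_iff_ae_notMem.1 hnull] with ω hsω hω
  obtain ⟨t, ht⟩ : ∃ t : ℕ, ω ∉ L (t + 1) := by simpa using hω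
  have hio : ∀ M, ∃ m ≥ M, ω ∉ E (t + 1) m := by simpa [hL] using ht
  have hτ0 : Tendsto (fun m => ENNReal.ofReal (2 * ((t : ℝ) + 1)) * τ m ω) atTop (𝓝 0) := by
    have hfin : ∑' n, ‖X n ω‖ₑ ^ 2 ≠ ∞ := by
      have := hsω.tsum_ofReal_ne_top
      convert this using 4 with n
      rw [ENNReal.ofReal_pow (norm_nonneg _), ofReal_norm]
    have h1 := ENNReal.tendsto_sum_nat_add (fun n => ‖X n ω‖ₑ ^ 2) hfin
    have h2 := h1.ennrpow_const (1 / 2)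
    rw [ENNReal.zero_rpow_of_pos (by norm_num)] at h2
    have h3 := ENNReal.Tendsto.const_mul (a := ENNReal.ofReal (2 * ((t : ℝ) + 1))) h2
      (Or.inr ENNReal.ofReal_ne_top)
    rwa [mul_zero] at h3
  rw [EMetric.cauchySeq_iff]
  intro ε hε
  obtain ⟨M, hM⟩ := eventually_atTop.1 (hτ0.eventually (gt_mem_nhds (ENNReal.half_pos hε.ne')))
  obtain ⟨m, hmM, hmE⟩ := hio M
  have hdist : ∀ N ≥ m, edist (∑ n ∈ Finset.range N, X n ω * g n ω)
      (∑ n ∈ Finset.range m, X n ω * g n ω) < ε / 2 := by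
    intro N hN
    obtain ⟨k, rfl⟩ := Nat.exists_eq_add_of_le hN
    have h1 : ¬ ∃ N, ENNReal.ofReal (2 * ((t : ℝ) + 1)) * τ m ω
      < ‖∑ n ∈ Finset.range N, X (n + m) ω * g (n + m) ω‖ₑ := hmE
    push Not at h1
    rw [edist_eq_enorm_sub, Finset.sum_range_add, add_sub_cancel_left]
    refine lt_of_le_of_lt ?_ (hM m hmM)
    simpa [add_comm] using h1 k
  refine ⟨m, fun N hN N' hN' => ?_⟩
  calc _ ≤ _ := edist_triangle_right _ _ (∑ n ∈ Finset.range m, X n ω * g n ω)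
    _ < ε / 2 + ε / 2 := ENNReal.add_lt_add (hdist N hN) (hdist N' hN')
    _ = ε := ENNReal.add_halves ε

/-! ### Finite nets and Borel–Cantelli for their increments. -/

/-- Cut space into cubes of side `exp (-k / H)` and choose one point of `A` in each cube that meets
`A`. With `H` the lower Hölder exponent of `ρ`, this Euclidean mesh becomes a `ρ`-mesh of order `exp
(-k)`. -/
theorem exists_exp_nets {d : ℕ} {A : Set (EuclideanSpace ℝ (Fin d))}
    (hA : Bornology.IsBounded A) {H : ℝ} (hH : 0 < H) :
    ∃ (b : ℝ) (π : ℕ → EuclideanSpace ℝ (Fin d) → EuclideanSpace ℝ (Fin d))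
      (T : ℕ → Finset (EuclideanSpace ℝ (Fin d))), 0 ≤ b ∧
      (∀ k, ∀ x ∈ T k, x ∈ A) ∧ (∀ k, ∀ x ∈ A, π k x ∈ T k) ∧
      (∀ k, ((T k).card : ℝ) ≤ Real.exp (b * (k + 1))) ∧
      (∀ k, ∀ x ∈ A, ‖x - π k x‖ ≤ d * Real.exp (-(k / H))) := by
  classical
  obtain ⟨R, hR0, hR⟩ := hA.exists_pos_norm_le
  set h : ℕ → ℝ := fun k => Real.exp (-(k / H)) with hh
  have hpos : ∀ k, 0 < h k := fun k => Real.exp_pos _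
  set q : ℕ → EuclideanSpace ℝ (Fin d) → (Fin d → ℤ) := fun k x i => ⌊x i / h k⌋ with hq
  set M : ℕ → ℕ := fun k => ⌈R / h k⌉₊ + 1 with hM
  set G : ℕ → Finset (Fin d → ℤ) := fun k =>
    Fintype.piFinset fun _ => Finset.Icc (-(M k : ℤ)) (M k) with hG
  have hqG : ∀ k, ∀ x ∈ A, q k x ∈ G k := by
    intro k x hx
    rw [hG, Fintype.mem_piFinset]
    intro i
    have hxi : |x i| ≤ R := (PiLp.norm_apply_le x i).trans (hR x hx)
    have hc : R / h k ≤ M k := by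
      have := Nat.le_ceil (R / h k); simp only [hM]; push_cast; linarith
    have h1 : x i / h k ≤ M k := (div_le_div_of_nonneg_right (abs_le.1 hxi).2 (hpos k).le).trans hc
    have h2 : -(M k : ℝ) ≤ x i / h k := by
      have := div_le_div_of_nonneg_right (abs_le.1 hxi).1 (hpos k).le
      rw [neg_div] at this; linarith
    rw [Finset.mem_Icc]
    constructor
    · exact Int.le_floor.2 (by push_cast; exact h2)
    · have h3 := (Int.floor_le (x i / h k)).trans h1
      exact (Int.cast_le (R := ℝ)).1 (by rw [Int.cast_natCast]; exact h3)
  -- Each coordinate takes at most `2 M + 1 ≤ (2 R + 5) exp (k / H)` values; the exponent `b` comes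
  -- from the `d`-th power of this.
  refine ⟨d * (Real.log (2 * R + 5) + 1 / H),
    fun k x => Function.invFunOn (q k) A (q k x),
    fun k => ((G k).filter fun u => ∃ x ∈ A, q k x = u).image (Function.invFunOn (q k) A),
    ?_, ?_, ?_, ?_, ?_⟩
  · have : 0 ≤ Real.log (2 * R + 5) := Real.log_nonneg (by linarith)
    positivity
  · intro k x hx
    obtain ⟨u, hu, rfl⟩ := Finset.mem_image.1 hx
    exact Function.invFunOn_mem (Finset.mem_filter.1 hu).2
  · intro k x hx
    exact Finset.mem_image_of_mem _ (Finset.mem_filter.2 ⟨hqG k x hx, x, hx, rfl⟩)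
  · intro k
    have hcard : (G k).card = (2 * M k + 1) ^ d := by
      rw [hG, Fintype.card_piFinset]
      simp only [Int.card_Icc, Finset.prod_const, Finset.card_univ, Fintype.card_fin]
      congr 1; omega
    have hc : (2 * (M k : ℝ) + 1) ≤ (2 * R + 5) * Real.exp (k / H) := by
      have h1 := (Nat.ceil_lt_add_one (show 0 ≤ R / h k from div_nonneg hR0.le (hpos k).le)).le
      have h2 : R / h k = R * Real.exp (k / H) := by
        simp only [hh, Real.exp_neg, div_inv_eq_mul]
      have h3 : 1 ≤ Real.exp (k / H) := Real.one_le_exp (by positivity)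
      simp only [hM]; push_cast
      rw [h2] at h1 ⊢
      nlinarith
    calc _ ≤ ((G k).card : ℝ) := by
            exact_mod_cast Finset.card_image_le.trans (Finset.card_filter_le _ _)
      _ = (2 * (M k : ℝ) + 1) ^ d := by rw [hcard]; push_cast; ring
      _ ≤ ((2 * R + 5) * Real.exp (k / H)) ^ d := by gcongr
      _ = Real.exp (d * (Real.log (2 * R + 5) + k / H)) := by
          rw [Real.exp_nat_mul, Real.exp_add, Real.exp_log (by linarith)]
      _ ≤ _ := by
          refine Real.exp_le_exp.2 ?_
          have : 0 ≤ Real.log (2 * R + 5) := Real.log_nonneg (by linarith)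
          have hk : (0 : ℝ) ≤ k := Nat.cast_nonneg k
          have hH' : 0 ≤ 1 / H := by positivity
          rw [mul_assoc]
          refine mul_le_mul_of_nonneg_left ?_ (Nat.cast_nonneg d)
          rw [show (k : ℝ) / H = 1 / H * k by ring]
          nlinarith
  · intro k x hx
    set y := Function.invFunOn (q k) A (q k x) with hy
    have hqy : q k y = q k x := Function.invFunOn_eq ⟨x, hx, rfl⟩
    have hi : ∀ i, ‖(x - y) i‖ ≤ h k := by
      intro i
      have h1 : ⌊y i / h k⌋ = ⌊x i / h k⌋ := congrFun hqy i
      have h2 := Int.abs_sub_lt_one_of_floor_eq_floor h1.symm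
      rw [← sub_div, abs_div, abs_of_pos (hpos k), div_lt_one (hpos k)] at h2
      simpa using h2.le
    rw [EuclideanSpace.norm_eq]
    refine Real.sqrt_le_iff.2 ⟨by positivity, ?_⟩
    calc ∑ i, ‖(x - y) i‖ ^ 2 ≤ ∑ _i : Fin d, h k ^ 2 := by
          gcongr with i; exact hi i
      _ = d * h k ^ 2 := by simp
      _ ≤ (d * h k) ^ 2 := by
          rw [mul_pow]
          refine mul_le_mul_of_nonneg_right ?_ (sq_nonneg _)
          exact_mod_cast Nat.le_self_pow two_ne_zero d

/-- Conditionally sub-Gaussian chaining bound: almost surely, on all sufficiently fine levels of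
finite sets of exponentially growing size, the increments of the partial sums are controlled by
the conditional parameter. -/
theorem ae_eventually_increments_le {Ω : Type*} [MeasurableSpace Ω] {P : Measure Ω}
    [IsProbabilityMeasure P] {d : ℕ} {K : Set (EuclideanSpace ℝ (Fin d))}
    {W : ℕ → EuclideanSpace ℝ (Fin d) → Ω → ℂ} {g : ℕ → Ω → ℂ} (hWg : CondSubGaussianSeq P K W g)
    {T : ℕ → Finset (EuclideanSpace ℝ (Fin d))} (hT : ∀ k, ∀ x ∈ T k, x ∈ K) {b : ℝ}
    (hb : 0 ≤ b) (hcard : ∀ k, ((T k).card : ℝ) ≤ Real.exp (b * (k + 1))) :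
    ∃ c : ℝ, 0 < c ∧ ∀ᵐ ω ∂P, ∀ᶠ k : ℕ in atTop, ∀ p ∈ T k, ∀ q ∈ T k ∪ T (k + 1), ∀ N,
      ‖partialSum W g N q ω - partialSum W g N p ω‖ₑ
        ≤ ENNReal.ofReal (c * Real.sqrt k) * condParam W q p ω := by
  classical
  -- With `t = a √k` each bad event has probability at most `4 exp (-(2b + 1) k)`, against at most
  -- `2 exp (b (2k + 3))` pairs; the excess `exp (-k)` is summable.
  set a : ℝ := Real.sqrt (4 * b + 2) with ha
  have ha0 : 0 < a := Real.sqrt_pos.2 (by linarith)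
  have ha2 : a ^ 2 = 4 * b + 2 := Real.sq_sqrt (by linarith)
  refine ⟨2 * a, by positivity, ?_⟩
  set B : EuclideanSpace ℝ (Fin d) × EuclideanSpace ℝ (Fin d) → ℝ → Set Ω := fun r t =>
    {ω | ∃ N, ENNReal.ofReal (2 * t) * condParam W r.2 r.1 ω
      < ‖partialSum W g N r.2 ω - partialSum W g N r.1 ω‖ₑ} with hB
  have hBP : ∀ r, r.1 ∈ K → r.2 ∈ K → ∀ t, 0 ≤ t →
      P (B r t) ≤ 4 * ENNReal.ofReal (Real.exp (-(t ^ 2 / 2))) := by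
    intro r h1 h2 t ht
    -- The value `t = 0` occurs at level `k = 0`, where the claimed bound is `4`.
    rcases ht.eq_or_lt with rfl | ht
    · refine prob_le_one.trans ?_
      simp only [ne_eq, OfNat.ofNat_ne_zero, not_false_eq_true, zero_pow, zero_div, neg_zero,
        Real.exp_zero, ENNReal.ofReal_one, mul_one]
      norm_num
    have := measure_exists_lt_norm_sum_le_of_indepFun hWg.measurable_g hWg.indep_g
      hWg.subGaussian_g (X := fun n ω => W n r.2 ω - W n r.1 ω)
      (fun n => (hWg.measurable_W n _ h2).sub (hWg.measurable_W n _ h1))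
      (hWg.indep_W_g.comp (φ := fun (w : ℕ × K → ℂ) n => w (n, ⟨r.2, h2⟩) - w (n, ⟨r.1, h1⟩))
        (ψ := id) (by fun_prop) measurable_id) ht
    simpa only [hB, condParam, partialSum, ← Finset.sum_sub_distrib, sub_mul] using this
  set Q : ℕ → Finset (EuclideanSpace ℝ (Fin d) × EuclideanSpace ℝ (Fin d)) := fun k =>
    T k ×ˢ (T k ∪ T (k + 1)) with hQ
  have hQc : ∀ k, ((Q k).card : ℝ) ≤ 2 * Real.exp (b * (2 * k + 3)) := by
    intro k
    have h1 : ((T k ∪ T (k + 1)).card : ℝ) ≤ 2 * Real.exp (b * (k + 2)) := by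
      have h2 : ((T k ∪ T (k + 1)).card : ℝ) ≤ (T k).card + (T (k + 1)).card := by
        exact_mod_cast Finset.card_union_le _ _
      have h3 := hcard k
      have h4 := hcard (k + 1)
      have h5 : Real.exp (b * (k + 1)) ≤ Real.exp (b * (k + 2)) := by
        gcongr; linarith
      push_cast at h4
      rw [show (k : ℝ) + 1 + 1 = k + 2 by ring] at h4
      linarith
    rw [hQ, Finset.card_product, Nat.cast_mul]
    calc _ ≤ Real.exp (b * (k + 1)) * (2 * Real.exp (b * (k + 2))) :=
          mul_le_mul (hcard k) h1 (Nat.cast_nonneg _) (Real.exp_pos _).le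
      _ = 2 * Real.exp (b * (2 * k + 3)) := by
          rw [mul_left_comm, ← Real.exp_add]; ring_nf
  have hPk : ∀ k : ℕ, P (⋃ r ∈ Q k, B r (a * Real.sqrt k))
      ≤ ENNReal.ofReal (8 * Real.exp (3 * b) * Real.exp (-(1 : ℝ) * k)) := by
    intro k
    calc _ ≤ ∑ r ∈ Q k, P (B r (a * Real.sqrt k)) := measure_biUnion_finset_le _ _
      _ ≤ ∑ r ∈ Q k, 4 * ENNReal.ofReal (Real.exp (-((a * Real.sqrt k) ^ 2 / 2))) := by
          refine Finset.sum_le_sum fun r hr => hBP r ?_ ?_ _ (by positivity)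
          · exact hT k _ (Finset.mem_product.1 hr).1
          · rcases Finset.mem_union.1 (Finset.mem_product.1 hr).2 with h | h
            exacts [hT _ _ h, hT _ _ h]
      _ = ENNReal.ofReal ((Q k).card * (4 * Real.exp (-((a * Real.sqrt k) ^ 2 / 2)))) := by
          rw [Finset.sum_const, nsmul_eq_mul, ENNReal.ofReal_mul (Nat.cast_nonneg _),
            ENNReal.ofReal_mul (by norm_num), ENNReal.ofReal_natCast]
          norm_num
      _ ≤ _ := by
          refine ENNReal.ofReal_le_ofReal ?_
          calc _ ≤ 2 * Real.exp (b * (2 * k + 3))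
                * (4 * Real.exp (-((a * Real.sqrt k) ^ 2 / 2))) := by
                gcongr; exact hQc k
            _ = 8 * (Real.exp (b * (2 * k + 3)) * Real.exp (-((a * Real.sqrt k) ^ 2 / 2))) := by
                ring
            _ = _ := by
                rw [mul_assoc 8, ← Real.exp_add, ← Real.exp_add, mul_pow, ha2,
                  Real.sq_sqrt (Nat.cast_nonneg k)]
                ring_nf
  have hsum : ∑' k : ℕ, P (⋃ r ∈ Q k, B r (a * Real.sqrt k)) ≠ ∞ := by
    refine ne_top_of_le_ne_top ?_ (ENNReal.tsum_le_tsum hPk)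
    have h1 : Summable fun k : ℕ => 8 * Real.exp (3 * b) * Real.exp (-(1 : ℝ) * k) := by
      have := (Real.summable_pow_mul_exp_neg_nat_mul 0 one_pos).mul_left (8 * Real.exp (3 * b))
      simpa using this
    exact h1.tsum_ofReal_ne_top
  filter_upwards [ae_eventually_notMem hsum] with ω hω
  filter_upwards [hω] with k hk p hp q hq N
  by_contra! hcon
  refine hk (Set.mem_iUnion₂.2 ⟨(p, q), Finset.mem_product.2 ⟨hp, hq⟩, N, ?_⟩)
  rwa [← mul_assoc]

/-! ### Elementary estimates for powers, exponentials and logarithms. -/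

/-- Handles both signs of `η` at once: the loss is polynomial in `u`, to be absorbed by an
exponential factor in `u`. -/
theorem rpow_add_le_rpow_mul {l u : ℝ} (hl : 1 ≤ l) (hu : 0 ≤ u) (η : ℝ) :
    (l + u) ^ η ≤ l ^ η * (1 + u) ^ |η| := by
  rcases le_total 0 η with h | h
  · rw [abs_of_nonneg h, ← Real.mul_rpow (by linarith) (by linarith)]
    exact Real.rpow_le_rpow (by linarith) (by nlinarith) h
  · calc (l + u) ^ η ≤ l ^ η := Real.rpow_le_rpow_of_nonpos (by linarith) (by linarith) h
      _ ≤ l ^ η * (1 + u) ^ |η| :=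
        le_mul_of_one_le_right (by positivity) (Real.one_le_rpow (by linarith) (abs_nonneg η))

theorem exists_rpow_le_of_ratio_mem {m M : ℝ} (hm : 0 < m) (η : ℝ) :
    ∃ C : ℝ, 0 < C ∧ ∀ l x : ℝ, 0 < l → m * l ≤ x → x ≤ M * l → x ^ η ≤ C * l ^ η := by
  rcases le_total 0 η with h | h
  · refine ⟨(max M 1) ^ η, by positivity, fun l x hl h1 h2 => ?_⟩
    rw [← Real.mul_rpow (by positivity) hl.le]
    have hml : 0 < m * l := by positivity
    exact Real.rpow_le_rpow (by linarith)
      (h2.trans (mul_le_mul_of_nonneg_right (le_max_left _ _) hl.le)) h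
  · refine ⟨m ^ η, by positivity, fun l x hl h1 h2 => ?_⟩
    rw [← Real.mul_rpow hm.le hl.le]
    exact Real.rpow_le_rpow_of_nonpos (by positivity) h1 h

theorem exists_one_add_rpow_mul_exp_neg_le (s : ℝ) {β : ℝ} (hβ : 0 < β) :
    ∃ C : ℝ, 0 < C ∧ ∀ u : ℝ, 0 ≤ u → (1 + u) ^ s * Real.exp (-β * u) ≤ C := by
  have h1 := tendsto_rpow_mul_exp_neg_mul_atTop_nhds_zero s β hβ
  obtain ⟨R, hR⟩ := eventually_atTop.1 (h1.eventually (gt_mem_nhds one_pos))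
  obtain ⟨C, hC⟩ := (isCompact_Icc (a := (0 : ℝ)) (b := R)).exists_bound_of_continuousOn
    (f := fun u : ℝ => (1 + u) ^ s * Real.exp (-β * u)) (by
      refine ContinuousOn.mul (ContinuousOn.rpow_const (by fun_prop) fun x hx => ?_) (by fun_prop)
      left; linarith [hx.1])
  refine ⟨max C (Real.exp β), lt_max_of_lt_right (Real.exp_pos _), fun u hu => ?_⟩
  rcases le_total u R with h | h
  · exact (le_abs_self _).trans ((hC u ⟨hu, h⟩).trans (le_max_left _ _))
  · refine le_trans ?_ (le_max_right _ _)
    have h2 := (hR (1 + u) (by linarith)).le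
    calc (1 + u) ^ s * Real.exp (-β * u) = ((1 + u) ^ s * Real.exp (-β * (1 + u))) * Real.exp β := by
          rw [mul_assoc, ← Real.exp_add]; ring_nf
      _ ≤ 1 * Real.exp β := by gcongr
      _ = _ := one_mul _

/-- Upper bound for `r ^ β * |log r| ^ η` on `r ≤ D * exp (-k)`. -/
theorem exists_rpow_mul_abs_log_rpow_le {β : ℝ} (hβ : 0 < β) (η : ℝ) {D : ℝ} (hD : 0 < D) :
    ∃ C : ℝ, 0 < C ∧ ∀ᶠ k : ℕ in atTop, ∀ r : ℝ, 0 < r → r ≤ D * Real.exp (-k) →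
      r ^ β * |Real.log r| ^ η ≤ C * (Real.exp (-β * k) * (k : ℝ) ^ η) := by
  obtain ⟨C₁, hC₁, h₁⟩ := exists_one_add_rpow_mul_exp_neg_le |η| hβ
  obtain ⟨C₂, hC₂, h₂⟩ := exists_rpow_le_of_ratio_mem (m := 1 / 2) (M := 2) (by norm_num) η
  refine ⟨D ^ β * C₁ * C₂, by positivity, ?_⟩
  filter_upwards [eventually_ge_atTop 2, eventually_ge_atTop ⌈2 * |Real.log D|⌉₊] with k hk2 hkD r hr hrD
  have hk : (2 : ℝ) ≤ k := by exact_mod_cast hk2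
  have hkD' : 2 * |Real.log D| ≤ k := (Nat.le_ceil _).trans (by exact_mod_cast hkD)
  -- Write `-log r = l + u` with `u ≥ 0`. Then `r ^ β` carries the factor `exp (-β u)`, so values of
  -- `r` far below the scale `exp (-k)` are harmless even when `η > 0`. The conditions on `k` make
  -- `l` at least one and comparable to `k`.
  set l : ℝ := k - Real.log D with hl
  have hl1 : 1 / 2 * k ≤ l := by linarith [le_abs_self (Real.log D)]
  have hl2 : l ≤ 2 * k := by linarith [neg_abs_le (Real.log D)]
  have hlog : Real.log r ≤ -l := by
    have := Real.log_le_log hr hrD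
    rw [Real.log_mul hD.ne' (Real.exp_pos _).ne', Real.log_exp] at this
    linarith
  set u : ℝ := -Real.log r - l with hu
  have hu0 : 0 ≤ u := by linarith
  have habs : |Real.log r| = l + u := by rw [abs_of_nonpos (by linarith)]; linarith
  have hrβ : r ^ β = D ^ β * Real.exp (-β * k) * Real.exp (-β * u) := by
    rw [Real.rpow_def_of_pos hr, Real.rpow_def_of_pos hD, ← Real.exp_add, ← Real.exp_add]
    congr 1
    simp only [hu, hl]; ring
  calc r ^ β * |Real.log r| ^ η
      ≤ D ^ β * Real.exp (-β * k) * Real.exp (-β * u) * (l ^ η * (1 + u) ^ |η|) := by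
        rw [hrβ, habs]
        gcongr
        exact rpow_add_le_rpow_mul (by linarith) hu0 η
    _ = D ^ β * Real.exp (-β * k) * l ^ η * ((1 + u) ^ |η| * Real.exp (-β * u)) := by ring
    _ ≤ D ^ β * Real.exp (-β * k) * (C₂ * (k : ℝ) ^ η) * C₁ := by
        have : 0 ≤ l ^ η := Real.rpow_nonneg (by linarith) _
        gcongr
        · exact h₂ k l (by linarith) hl1 hl2
        · exact h₁ u hu0
    _ = _ := by ring

/-- Tails of `∑ exp (-β k) k ^ η` are dominated by their first term. -/
theorem exists_sum_exp_mul_rpow_le {β : ℝ} (hβ : 0 < β) (η : ℝ) :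
    ∃ C : ℝ, 0 < C ∧ ∀ k : ℕ, 1 ≤ k → ∀ m : ℕ,
      ∑ i ∈ Finset.range m, Real.exp (-β * (k + i : ℕ)) * ((k + i : ℕ) : ℝ) ^ η
        ≤ C * (Real.exp (-β * k) * (k : ℝ) ^ η) := by
  -- Half of the decay rate absorbs the polynomial factor, the other half sums the geometric series.
  obtain ⟨C₁, hC₁, h₁⟩ := exists_one_add_rpow_mul_exp_neg_le |η| (half_pos hβ)
  have hs : Summable fun i : ℕ => Real.exp (-(β / 2) * i) := by
    simpa using Real.summable_pow_mul_exp_neg_nat_mul 0 (half_pos hβ)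
  refine ⟨C₁ * (∑' i : ℕ, Real.exp (-(β / 2) * i)),
    mul_pos hC₁ (hs.tsum_pos (fun i => (Real.exp_pos _).le) 0 (Real.exp_pos _)), ?_⟩
  intro k hk m
  have hk1 : (1 : ℝ) ≤ k := by exact_mod_cast hk
  calc _ ≤ ∑ i ∈ Finset.range m,
        Real.exp (-β * k) * (k : ℝ) ^ η * (C₁ * Real.exp (-(β / 2) * i)) := by
        refine Finset.sum_le_sum fun i _ => ?_
        have hi : (0 : ℝ) ≤ i := Nat.cast_nonneg i
        push_cast
        calc Real.exp (-β * (k + i)) * ((k : ℝ) + i) ^ η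
            ≤ Real.exp (-β * (k + i)) * ((k : ℝ) ^ η * (1 + i) ^ |η|) := by
              gcongr; exact rpow_add_le_rpow_mul hk1 hi η
          _ = Real.exp (-β * k) * (k : ℝ) ^ η *
              (((1 + (i : ℝ)) ^ |η| * Real.exp (-(β / 2) * i)) * Real.exp (-(β / 2) * i)) := by
              rw [show -β * ((k : ℝ) + i) = -β * k + (-(β / 2) * i + -(β / 2) * i) by ring,
                Real.exp_add, Real.exp_add]
              ring
          _ ≤ _ := by gcongr; exact h₁ i hi
    _ = Real.exp (-β * k) * (k : ℝ) ^ η *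
        (C₁ * ∑ i ∈ Finset.range m, Real.exp (-(β / 2) * i)) := by
        rw [← Finset.mul_sum, ← Finset.mul_sum]
    _ ≤ Real.exp (-β * k) * (k : ℝ) ^ η * (C₁ * ∑' i : ℕ, Real.exp (-(β / 2) * i)) := by
        gcongr
        exact hs.sum_le_tsum _ fun i _ => (Real.exp_pos _).le
    _ = _ := by ring

/-- Comparison of `exp (-β k) k ^ η` with `r ^ β * log (1 + r⁻¹) ^ η` for `r ≈ exp (-k)`. -/
theorem exists_exp_mul_rpow_le {β : ℝ} (hβ : 0 < β) (η : ℝ) :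
    ∃ C : ℝ, 0 < C ∧ ∀ k : ℕ, 1 ≤ k → ∀ r : ℝ, Real.exp (-(k + 1 : ℝ)) < r → r ≤ Real.exp (-k) →
      Real.exp (-β * k) * (k : ℝ) ^ η ≤ C * (r ^ β * Real.log (1 + r⁻¹) ^ η) := by
  obtain ⟨C, hC, h⟩ := exists_rpow_le_of_ratio_mem (m := 1 / 3) (M := 1) (by norm_num) η
  refine ⟨Real.exp β * C, by positivity, fun k hk r hr1 hr2 => ?_⟩
  have hk1 : (1 : ℝ) ≤ k := by exact_mod_cast hk
  have hr : 0 < r := (Real.exp_pos _).trans hr1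
  have hinv1 : Real.exp k ≤ r⁻¹ := by
    rw [← inv_inv (Real.exp k), ← Real.exp_neg]
    exact inv_anti₀ hr hr2
  have hinv2 : r⁻¹ ≤ Real.exp (k + 1) := by
    rw [← inv_inv (Real.exp (k + 1)), ← Real.exp_neg]
    exact inv_anti₀ (Real.exp_pos _) hr1.le
  have hL1 : (k : ℝ) ≤ Real.log (1 + r⁻¹) := by
    rw [Real.le_log_iff_exp_le (by positivity)]; linarith
  have hL2 : Real.log (1 + r⁻¹) ≤ 3 * k := by
    refine le_trans ?_ (show (k : ℝ) + 2 ≤ 3 * k by linarith)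
    rw [Real.log_le_iff_le_exp (by positivity)]
    have h1 : 1 ≤ Real.exp (k + 1 : ℝ) := Real.one_le_exp (by linarith)
    have h2 : 2 ≤ Real.exp 1 := by linarith [Real.add_one_le_exp (1 : ℝ)]
    have h3 : Real.exp (k + 2 : ℝ) = Real.exp (k + 1) * Real.exp 1 := by
      rw [← Real.exp_add]; ring_nf
    nlinarith
  have hexp : Real.exp (-β * k) ≤ Real.exp β * r ^ β := by
    have h1 : Real.exp (-(k + 1 : ℝ)) ^ β ≤ r ^ β :=
      Real.rpow_le_rpow (Real.exp_pos _).le hr1.le hβ.le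
    rw [← Real.exp_mul] at h1
    calc Real.exp (-β * k) = Real.exp β * Real.exp (-(k + 1 : ℝ) * β) := by
          rw [← Real.exp_add]; ring_nf
      _ ≤ _ := by gcongr
  calc _ ≤ Real.exp β * r ^ β * (C * Real.log (1 + r⁻¹) ^ η) := by
        have : 0 ≤ r ^ β := by positivity
        gcongr
        exact h _ _ (by linarith) (by linarith) (by linarith)
    _ = _ := by ring

theorem tendsto_exp_mul_rpow {β : ℝ} (hβ : 0 < β) (η : ℝ) :
    Tendsto (fun k : ℕ => Real.exp (-β * k) * (k : ℝ) ^ η) atTop (𝓝 0) := by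
  refine ((tendsto_rpow_mul_exp_neg_mul_atTop_nhds_zero η β hβ).comp
    tendsto_natCast_atTop_atTop).congr fun k => ?_
  simp [mul_comm]

/-! ### Deterministic chaining, moduli of continuity and uniform convergence. -/

/-- Chaining: increments controlled along nets of `ρ`-mesh `exp (-k)` give control of all
increments at scale `exp (-k)`. -/
theorem exists_chaining_bound {d : ℕ}
    {ρ : EuclideanSpace ℝ (Fin d) → EuclideanSpace ℝ (Fin d) → ℝ} (hρ : IsQuasiMetric ρ)
    {A : Set (EuclideanSpace ℝ (Fin d))}
    {π : ℕ → EuclideanSpace ℝ (Fin d) → EuclideanSpace ℝ (Fin d)}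
    {T : ℕ → Finset (EuclideanSpace ℝ (Fin d))} (hTA : ∀ k, ∀ x ∈ T k, x ∈ A)
    (hπT : ∀ k, ∀ x ∈ A, π k x ∈ T k) {D : ℝ} (hD : 0 < D)
    (hπρ : ∀ᶠ k : ℕ in atTop, ∀ x ∈ A, ρ x (π k x) ≤ D * Real.exp (-k))
    (hπlim : ∀ x ∈ A, Tendsto (fun k => π k x) atTop (𝓝 x))
    {F : ℕ → EuclideanSpace ℝ (Fin d) → ℂ} (hF : ∀ N, ContinuousOn (F N) A)
    {σ : EuclideanSpace ℝ (Fin d) → EuclideanSpace ℝ (Fin d) → ℝ≥0∞} {c : ℝ} (hc : 0 < c)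
    (hinc : ∀ᶠ k : ℕ in atTop, ∀ p ∈ T k, ∀ q ∈ T k ∪ T (k + 1), ∀ N,
      ‖F N q - F N p‖ₑ ≤ ENNReal.ofReal (c * Real.sqrt k) * σ q p)
    {ε C₀ β η : ℝ} (hε : 0 < ε) (hC₀ : 0 < C₀) (hβ : 0 < β)
    (hσ : ∀ x ∈ A, ∀ y ∈ A, ρ x y ≠ 0 → ρ x y < ε →
      σ x y ≤ ENNReal.ofReal (C₀ * ρ x y ^ β * |Real.log (ρ x y)| ^ η)) :
    ∃ C : ℝ, 0 < C ∧ ∀ᶠ k : ℕ in atTop,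
      (∀ x ∈ A, ∀ N, ‖F N x - F N (π k x)‖ ≤ C * (Real.exp (-β * k) * (k : ℝ) ^ (η + 1 / 2))) ∧
      (∀ x ∈ A, ∀ y ∈ A, ρ x y ≤ Real.exp (-k) → ∀ N,
        ‖F N x - F N y‖ ≤ C * (Real.exp (-β * k) * (k : ℝ) ^ (η + 1 / 2))) := by
  obtain ⟨κ, hκ, htri⟩ := hρ.quasi_triangle
  -- Applying the quasi-triangle inequality twice bounds `ρ (π k x) (π k y)` by `D' exp (-k)` when
  -- `ρ x y ≤ exp (-k)`; the links `π (k + 1) x`, `π k x` obey the same bound.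
  set D' : ℝ := κ * (D + κ * (1 + D)) with hD'
  have hD'0 : 0 < D' := by positivity
  obtain ⟨C₁, hC₁, h₁⟩ := exists_rpow_mul_abs_log_rpow_le hβ η hD'0
  obtain ⟨C₂, hC₂, h₂⟩ := exists_sum_exp_mul_rpow_le hβ (η + 1 / 2)
  set b : ℕ → ℝ := fun k => Real.exp (-β * k) * (k : ℝ) ^ (η + 1 / 2) with hb
  have hb0 : ∀ k, 0 ≤ b k := fun k => by positivity
  have hsmall : ∀ᶠ k : ℕ in atTop, D' * Real.exp (-(k : ℝ)) < ε := by
    have h : Tendsto (fun k : ℕ => D' * Real.exp (-(k : ℝ))) atTop (𝓝 (D' * 0)) :=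
      (Real.tendsto_exp_neg_atTop_nhds_zero.comp tendsto_natCast_atTop_atTop).const_mul D'
    rw [mul_zero] at h
    exact h.eventually (gt_mem_nhds hε)
  set c' : ℝ := c * (C₀ * C₁) with hc'
  have hstep : ∀ᶠ k : ℕ in atTop, ∀ p ∈ T k, ∀ q ∈ T k ∪ T (k + 1),
      ρ q p ≤ D' * Real.exp (-k) → ∀ N, ‖F N q - F N p‖ ≤ c' * b k := by
    filter_upwards [hinc, h₁, hsmall, eventually_ge_atTop 1] with k hk1 hk2 hk3 hk4 p hp q hq hpq N
    have hk0 : (0 : ℝ) < k := by exact_mod_cast hk4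
    by_cases hz : ρ q p = 0
    · rw [(hρ.eq_zero_iff q p).1 hz, sub_self, norm_zero]
      exact mul_nonneg (by positivity) (hb0 k)
    have hqA : q ∈ A := by
      rcases Finset.mem_union.1 hq with h | h
      exacts [hTA _ _ h, hTA _ _ h]
    have hpos : 0 < ρ q p := lt_of_le_of_ne (hρ.nonneg q p) (Ne.symm hz)
    have h3 := (hk1 p hp q hq N).trans
      (mul_le_mul_right (hσ q hqA p (hTA _ _ hp) hz (hpq.trans_lt hk3)) _)
    rw [← ENNReal.ofReal_mul (by positivity), ← ofReal_norm,
      ENNReal.ofReal_le_ofReal_iff (by positivity)] at h3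
    calc _ ≤ _ := h3
      _ = c * Real.sqrt k * (C₀ * (ρ q p ^ β * |Real.log (ρ q p)| ^ η)) := by ring
      _ ≤ c * Real.sqrt k * (C₀ * (C₁ * (Real.exp (-β * k) * (k : ℝ) ^ η))) := by
          exact mul_le_mul_of_nonneg_left
            (mul_le_mul_of_nonneg_left (hk2 _ hpos hpq) hC₀.le) (by positivity)
      _ = c' * b k := by
          simp only [hb, hc']
          rw [Real.rpow_add hk0, ← Real.sqrt_eq_rpow]; ring
  obtain ⟨k₁, hk₁⟩ := eventually_atTop.1 (hstep.and (hπρ.and (eventually_ge_atTop 1)))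
  have hlink : ∀ k ≥ k₁, ∀ x ∈ A, ∀ N, ‖F N (π (k + 1) x) - F N (π k x)‖ ≤ c' * b k := by
    intro k hk x hx N
    refine (hk₁ k hk).1 _ (hπT k x hx) _ (Finset.mem_union_right _ (hπT (k + 1) x hx)) ?_ N
    have e1 := (hk₁ k hk).2.1 x hx
    have e2 := (hk₁ (k + 1) (by omega)).2.1 x hx
    have e3 : Real.exp (-((k + 1 : ℕ) : ℝ)) ≤ Real.exp (-(k : ℝ)) := by
      gcongr; simp
    rw [hρ.symm] at e2
    have e4 : D * Real.exp (-((k + 1 : ℕ) : ℝ)) ≤ D * Real.exp (-(k : ℝ)) := by gcongr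
    have e5 : (1 : ℝ) * D ≤ κ * (1 + D) :=
      mul_le_mul hκ (by linarith) hD.le (by linarith)
    calc ρ (π (k + 1) x) (π k x) ≤ κ * (ρ (π (k + 1) x) x + ρ x (π k x)) := htri _ _ _
      _ ≤ κ * ((D + 1 * D) * Real.exp (-(k : ℝ))) := by gcongr; linarith
      _ ≤ κ * ((D + κ * (1 + D)) * Real.exp (-(k : ℝ))) := by gcongr
      _ = _ := by rw [hD']; ring
  have hproj : ∀ k ≥ k₁, ∀ x ∈ A, ∀ N, ‖F N x - F N (π k x)‖ ≤ c' * C₂ * b k := by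
    intro k hk x hx N
    -- Continuity of the partial sums along `π (k + m) x → x` reduces the bound to finite
    -- telescoping sums.
    have hlim : Tendsto (fun m => ‖F N (π (k + m) x) - F N (π k x)‖) atTop
        (𝓝 ‖F N x - F N (π k x)‖) := by
      refine Tendsto.norm (Tendsto.sub_const ?_ _)
      have h5 : Tendsto (fun m => π (k + m) x) atTop (𝓝[A] x) :=
        tendsto_nhdsWithin_iff.2 ⟨((hπlim x hx).comp (tendsto_add_atTop_nat k)).congr fun m => by
          simp [add_comm], Eventually.of_forall fun m => hTA _ _ (hπT _ x hx)⟩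
      exact (hF N x hx).tendsto.comp h5
    refine le_of_tendsto' hlim fun m => ?_
    have h6 := dist_le_range_sum_of_dist_le (f := fun i => F N (π (k + i) x)) m
      (d := fun i => c' * b (k + i)) (fun {i} _ => by
        rw [dist_comm, dist_eq_norm]
        exact hlink (k + i) (by omega) x hx N)
    rw [dist_comm, dist_eq_norm, ← Finset.mul_sum] at h6
    calc _ ≤ _ := h6
      _ ≤ c' * (C₂ * b k) := by
          have hc'0 : 0 < c' := by positivity
          gcongr
          exact h₂ k (hk₁ k hk).2.2 m
      _ = _ := by ring
  have hc'0 : 0 < c' := by positivity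
  refine ⟨c' * C₂ + (c' + c' * C₂), by positivity, eventually_atTop.2 ⟨k₁, fun k hk => ⟨?_, ?_⟩⟩⟩
  · intro x hx N
    refine (hproj k hk x hx N).trans (mul_le_mul_of_nonneg_right ?_ (hb0 k))
    have : 0 < c' * C₂ := by positivity
    linarith
  · intro x hx y hy hxy N
    have e1 := hproj k hk x hx N
    have e2 := hproj k hk y hy N
    have e3 : ‖F N (π k x) - F N (π k y)‖ ≤ c' * b k := by
      refine (hk₁ k hk).1 _ (hπT k y hy) _ (Finset.mem_union_left _ (hπT k x hx)) ?_ N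
      have e4 := (hk₁ k hk).2.1 x hx
      have e5 := (hk₁ k hk).2.1 y hy
      rw [hρ.symm] at e4
      calc ρ (π k x) (π k y) ≤ κ * (ρ (π k x) x + ρ x (π k y)) := htri _ _ _
        _ ≤ κ * (ρ (π k x) x + κ * (ρ x y + ρ y (π k y))) := by gcongr; exact htri _ _ _
        _ ≤ κ * (D * Real.exp (-k) + κ * (Real.exp (-k) + D * Real.exp (-k))) := by gcongr
        _ = _ := by rw [hD']; ring
    calc ‖F N x - F N y‖ = ‖(F N x - F N (π k x)) + ((F N (π k x) - F N (π k y))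
          - (F N y - F N (π k y)))‖ := by congr 1; ring
      _ ≤ c' * C₂ * b k + (c' * b k + c' * C₂ * b k) :=
          (norm_add_le _ _).trans (add_le_add e1 ((norm_sub_le _ _).trans (add_le_add e3 e2)))
      _ = _ := by ring

/-- Small distances are matched with the scale `k = ⌊-log ρ⌋`. At larger distances the modulus is
bounded below by compactness, so the uniform bound on `F` suffices. -/
theorem exists_modulus_of_scales {d : ℕ}
    {ρ : EuclideanSpace ℝ (Fin d) → EuclideanSpace ℝ (Fin d) → ℝ} (hρ : IsQuasiMetric ρ)
    {A : Set (EuclideanSpace ℝ (Fin d))} (hA : IsCompact A)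
    {F : ℕ → EuclideanSpace ℝ (Fin d) → ℂ} {β η C B : ℝ} (hβ : 0 < β) (hC : 0 < C)
    (hscale : ∀ᶠ k : ℕ in atTop, ∀ x ∈ A, ∀ y ∈ A, ρ x y ≤ Real.exp (-k) → ∀ N,
        ‖F N x - F N y‖ ≤ C * (Real.exp (-β * k) * (k : ℝ) ^ η))
    (hB : ∀ x ∈ A, ∀ N, ‖F N x‖ ≤ B) :
    ∃ C' : ℝ, 0 < C' ∧ ∀ x ∈ A, ∀ y ∈ A, ∀ N,
      ‖F N x - F N y‖ ≤ C' * ρ x y ^ β * Real.log (1 + (ρ x y)⁻¹) ^ η := by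
  obtain ⟨k₁, hk₁⟩ := eventually_atTop.1 (hscale.and (eventually_ge_atTop 1))
  obtain ⟨C₁, hC₁, h₁⟩ := exists_exp_mul_rpow_le hβ η
  set φ : ℝ → ℝ := fun r => r ^ β * Real.log (1 + r⁻¹) ^ η with hφ
  have hlogpos : ∀ r : ℝ, 0 < r → 0 < Real.log (1 + r⁻¹) := fun r hr =>
    Real.log_pos (by have := inv_pos.2 hr; linarith)
  have hφpos : ∀ r : ℝ, 0 < r → 0 < φ r := fun r hr =>
    mul_pos (Real.rpow_pos_of_pos hr _) (Real.rpow_pos_of_pos (hlogpos r hr) _)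
  obtain ⟨M, hM⟩ := (hA.prod hA).exists_bound_of_continuousOn hρ.continuous.continuousOn
  obtain ⟨C₂, hC₂⟩ := (isCompact_Icc (a := Real.exp (-k₁)) (b := M)).exists_bound_of_continuousOn
    (f := fun r => (φ r)⁻¹) (by
      have hpos : ∀ r ∈ Set.Icc (Real.exp (-k₁)) M, 0 < r := fun r hr =>
        (Real.exp_pos _).trans_le hr.1
      have hinv : ContinuousOn (fun r : ℝ => 1 + r⁻¹) (Set.Icc (Real.exp (-k₁)) M) :=
        continuousOn_const.add (continuousOn_id.inv₀ fun r hr => (hpos r hr).ne')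
      refine ContinuousOn.inv₀ (ContinuousOn.mul ?_ ?_) fun r hr => (hφpos r (hpos r hr)).ne'
      · exact continuousOn_id.rpow_const fun r hr => Or.inl (hpos r hr).ne'
      · refine ContinuousOn.rpow_const (hinv.log fun r hr => ?_) fun r hr =>
          Or.inl (hlogpos r (hpos r hr)).ne'
        have := inv_pos.2 (hpos r hr)
        positivity)
  refine ⟨C * C₁ + 2 * |B| * |C₂|, by positivity, fun x hx y hy N => ?_⟩
  rw [mul_assoc]
  -- At `ρ x y = 0` the logarithmic factor is `0 ^ η`, whatever its value; `0 ^ β = 0` cancels it.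
  by_cases hz : ρ x y = 0
  · rw [(hρ.eq_zero_iff x y).1 hz, sub_self, norm_zero, (hρ.eq_zero_iff y y).2 rfl,
      Real.zero_rpow hβ.ne']
    simp
  have hr : 0 < ρ x y := lt_of_le_of_ne (hρ.nonneg x y) (Ne.symm hz)
  have hφr := hφpos _ hr
  rcases le_or_gt (ρ x y) (Real.exp (-k₁)) with h | h
  · have hlog : (k₁ : ℝ) ≤ -Real.log (ρ x y) := by
      have := (Real.log_le_iff_le_exp hr).2 h; linarith
    set k : ℕ := ⌊-Real.log (ρ x y)⌋₊ with hk
    have hkk : k₁ ≤ k := Nat.le_floor hlog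
    have hk2 : (k : ℝ) ≤ -Real.log (ρ x y) := Nat.floor_le ((Nat.cast_nonneg k₁).trans hlog)
    have hk3 : -Real.log (ρ x y) < k + 1 := Nat.lt_floor_add_one _
    have h3 : ρ x y ≤ Real.exp (-k) := (Real.log_le_iff_le_exp hr).1 (by linarith)
    have h4 : Real.exp (-(k + 1 : ℝ)) < ρ x y := (Real.lt_log_iff_exp_lt hr).1 (by linarith)
    calc _ ≤ _ := (hk₁ k hkk).1 x hx y hy h3 N
      _ ≤ C * (C₁ * φ (ρ x y)) := by
          exact mul_le_mul_of_nonneg_left (h₁ k (hk₁ k hkk).2 _ h4 h3) hC.le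
      _ = C * C₁ * φ (ρ x y) := by ring
      _ ≤ _ := by
          refine mul_le_mul_of_nonneg_right ?_ hφr.le
          have : 0 ≤ 2 * |B| * |C₂| := by positivity
          linarith
  · have h2 := hC₂ (ρ x y) ⟨h.le, (le_abs_self _).trans (hM (x, y) ⟨hx, hy⟩)⟩
    have h3 : (φ (ρ x y))⁻¹ ≤ |C₂| := (le_abs_self _).trans (h2.trans (le_abs_self _))
    have h4 : 1 ≤ |C₂| * φ (ρ x y) := by
      rwa [inv_le_iff_one_le_mul₀ hφr] at h3
    calc _ ≤ ‖F N x‖ + ‖F N y‖ := norm_sub_le _ _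
      _ ≤ 2 * |B| * 1 := by linarith [hB x hx N, hB y hy N, le_abs_self B]
      _ ≤ 2 * |B| * (|C₂| * φ (ρ x y)) := by gcongr
      _ = 2 * |B| * |C₂| * φ (ρ x y) := by ring
      _ ≤ _ := by
          refine mul_le_mul_of_nonneg_right ?_ hφr.le
          have : 0 ≤ C * C₁ := by positivity
          linarith

/-- Uniform convergence on `A` from convergence on nets that approximate uniformly in the index. -/
theorem uniformCauchySeqOn_of_nets {X : Type*} {A : Set X} {π : ℕ → X → X} {T : ℕ → Finset X}
    (hπT : ∀ k, ∀ x ∈ A, π k x ∈ T k) {F : ℕ → X → ℂ}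
    (hconv : ∀ k, ∀ p ∈ T k, CauchySeq fun N => F N p) {b : ℕ → ℝ}
    (hb : Tendsto b atTop (𝓝 0))
    (hproj : ∀ᶠ k : ℕ in atTop, ∀ x ∈ A, ∀ N, ‖F N x - F N (π k x)‖ ≤ b k) :
    UniformCauchySeqOn F atTop A := by
  rw [Metric.uniformCauchySeqOn_iff]
  intro ε hε
  obtain ⟨k, hk, hbk⟩ := (hproj.and (hb.eventually (gt_mem_nhds (show 0 < ε / 4 by positivity)))).exists
  have hT : ∀ᶠ M : ℕ in atTop, ∀ p ∈ T k, ∀ m ≥ M, ∀ n ≥ M, dist (F m p) (F n p) < ε / 4 := by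
    rw [Filter.eventually_all_finset]
    intro p hp
    obtain ⟨M, hM⟩ := Metric.cauchySeq_iff.1 (hconv k p hp) (ε / 4) (by positivity)
    filter_upwards [eventually_ge_atTop M] with M' hM' m hm n hn
    exact hM m (le_trans hM' hm) n (le_trans hM' hn)
  obtain ⟨M, hM⟩ := hT.exists
  refine ⟨M, fun m hm n hn x hx => ?_⟩
  have h1 := hM _ (hπT k x hx) m hm n hn
  have h2 := hk x hx m
  have h3 := hk x hx n
  rw [← dist_eq_norm] at h2 h3
  have h4 := dist_triangle4 (F m x) (F m (π k x)) (F n (π k x)) (F n x)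
  rw [dist_comm (F n (π k x))] at h4
  linarith

/-! ### Nets for the quasi-metric, assembly, and localisation by compactness. -/

theorem isCompact_box {d : ℕ} (a b : Fin d → ℝ) : IsCompact (box a b) := by
  have h : box a b = (EuclideanSpace.equiv (Fin d) ℝ).toHomeomorph ⁻¹'
      Set.pi Set.univ fun j => Set.Icc (a j) (b j) := by
    ext x
    exact ⟨fun h j _ => h j, fun h j => h j (Set.mem_univ j)⟩
  rw [h, Homeomorph.isCompact_preimage]
  exact isCompact_univ_pi fun j => isCompact_Icc

/-- Nets of a bounded set with `ρ`-mesh `exp (-k)` and exponentially growing size. -/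
theorem exists_quasiMetric_nets {d : ℕ}
    {ρ : EuclideanSpace ℝ (Fin d) → EuclideanSpace ℝ (Fin d) → ℝ} (hρc : IsHolderComparable ρ)
    {A : Set (EuclideanSpace ℝ (Fin d))} (hA : Bornology.IsBounded A) :
    ∃ (b D : ℝ) (π : ℕ → EuclideanSpace ℝ (Fin d) → EuclideanSpace ℝ (Fin d))
      (T : ℕ → Finset (EuclideanSpace ℝ (Fin d))), 0 ≤ b ∧ 0 < D ∧
      (∀ k, ∀ x ∈ T k, x ∈ A) ∧ (∀ k, ∀ x ∈ A, π k x ∈ T k) ∧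
      (∀ k, ((T k).card : ℝ) ≤ Real.exp (b * (k + 1))) ∧
      (∀ᶠ k : ℕ in atTop, ∀ x ∈ A, ρ x (π k x) ≤ D * Real.exp (-k)) ∧
      (∀ x ∈ A, Tendsto (fun k => π k x) atTop (𝓝 x)) := by
  obtain ⟨H, _, _, c, hH, _, _, _, hc, hcomp⟩ := hρc
  obtain ⟨b, π, T, hb, hTA, hπT, hcard, hdist⟩ := exists_exp_nets hA hH
  have hlim : Tendsto (fun k : ℕ => (d : ℝ) * Real.exp (-(k / H))) atTop (𝓝 0) := by
    have h : Tendsto (fun k : ℕ => (d : ℝ) * Real.exp (-((k : ℝ) / H))) atTop (𝓝 (d * 0)) :=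
      (Real.tendsto_exp_neg_atTop_nhds_zero.comp
        (tendsto_natCast_atTop_atTop.atTop_div_const hH)).const_mul _
    rwa [mul_zero] at h
  -- The added `1` keeps the constant positive when `d = 0`.
  refine ⟨b, c * ((d : ℝ) ^ H + 1), π, T, hb, by positivity, hTA, hπT, hcard, ?_, ?_⟩
  · filter_upwards [hlim.eventually (gt_mem_nhds one_pos)] with k hk x hx
    have h1 := hdist k x hx
    calc ρ x (π k x) ≤ c * ‖x - π k x‖ ^ H := (hcomp _ _ (h1.trans hk.le)).2
      _ ≤ c * (d * Real.exp (-(k / H))) ^ H := by gcongr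
      _ = c * ((d : ℝ) ^ H * Real.exp (-k)) := by
          rw [Real.mul_rpow (Nat.cast_nonneg d) (Real.exp_pos _).le, ← Real.exp_mul]
          congr 3
          field_simp
      _ ≤ c * (((d : ℝ) ^ H + 1) * Real.exp (-k)) := by gcongr; linarith
      _ = _ := by ring
  · intro x hx
    rw [tendsto_iff_norm_sub_tendsto_zero]
    refine squeeze_zero (fun k => norm_nonneg _) (fun k => ?_) hlim
    rw [norm_sub_rev]
    exact hdist k x hx

theorem ae_cauchySeq_partialSum {Ω : Type*} [MeasurableSpace Ω] {P : Measure Ω}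
    [IsProbabilityMeasure P] {d : ℕ} {K : Set (EuclideanSpace ℝ (Fin d))}
    {W : ℕ → EuclideanSpace ℝ (Fin d) → Ω → ℂ} {g : ℕ → Ω → ℂ} (hWg : CondSubGaussianSeq P K W g)
    {x : EuclideanSpace ℝ (Fin d)} (hx : x ∈ K) :
    ∀ᵐ ω ∂P, CauchySeq fun N => partialSum W g N x ω :=
  ae_cauchySeq_sum_of_indepFun hWg.measurable_g hWg.indep_g hWg.subGaussian_g
    (fun n => hWg.measurable_W n x hx)
    (hWg.indep_W_g.comp (φ := fun (w : ℕ × K → ℂ) n => w (n, ⟨x, hx⟩)) (ψ := id)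
      (by fun_prop) measurable_id) (hWg.summable_W x hx)

/-- Common core of both assertions: a bound on `s` at small `ρ`-distances is enough, because
chaining only sees fine scales. -/
theorem uniformRegularityOn_of_ae_condParam_le {Ω : Type*} [MeasurableSpace Ω] {P : Measure Ω}
    [IsProbabilityMeasure P] {d : ℕ} {K : Set (EuclideanSpace ℝ (Fin d))}
    {W : ℕ → EuclideanSpace ℝ (Fin d) → Ω → ℂ} {g : ℕ → Ω → ℂ} (hWg : CondSubGaussianSeq P K W g)
    {ρ : EuclideanSpace ℝ (Fin d) → EuclideanSpace ℝ (Fin d) → ℝ}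
    (hρ : IsQuasiMetric ρ) (hρc : IsHolderComparable ρ)
    {A : Set (EuclideanSpace ℝ (Fin d))} (hA : IsCompact A) (hAK : A ⊆ K) {β η : Ω → ℝ}
    (hβ : ∀ ω, 0 < β ω)
    (hσ : ∀ᵐ ω ∂P, ∃ ε C : ℝ, 0 < ε ∧ 0 < C ∧ ∀ x ∈ A, ∀ y ∈ A, ρ x y ≠ 0 → ρ x y < ε →
      condParam W x y ω ≤ ENNReal.ofReal (C * ρ x y ^ β ω * |Real.log (ρ x y)| ^ η ω)) :
    UniformRegularityOn P W g ρ A β η := by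
  obtain ⟨b, D, π, T, hb, hD, hTA, hπT, hcard, hπρ, hπlim⟩ :=
    exists_quasiMetric_nets hρc hA.isBounded
  obtain ⟨c, hc, hinc⟩ := ae_eventually_increments_le hWg
    (fun k x hx => hAK (hTA k x hx)) hb hcard
  have hconv : ∀ᵐ ω ∂P, ∀ k, ∀ p ∈ T k, CauchySeq fun N => partialSum W g N p ω := by
    refine ae_all_iff.2 fun k => ?_
    exact (ae_ball_iff (T k).countable_toSet).2 fun p hp =>
      ae_cauchySeq_partialSum hWg (hAK (hTA k p hp))
  have hall : ∀ᵐ ω ∂P, (∃ C : ℝ, 0 < C ∧ ∀ x ∈ A, ∀ y ∈ A, ∀ N : ℕ,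
      ‖partialSum W g N x ω - partialSum W g N y ω‖
        ≤ C * ρ x y ^ β ω * Real.log (1 + (ρ x y)⁻¹) ^ (η ω + 1 / 2)) ∧
      TendstoUniformlyOn (fun N x => partialSum W g N x ω) (fun x => seriesSum W g x ω) atTop A ∧
      (∀ N, ContinuousOn (fun x => partialSum W g N x ω) A) := by
    filter_upwards [hinc, hconv, hσ, ae_all_iff.2 hWg.continuous_W] with ω h1 h2 h3 h4
    obtain ⟨ε, C₀, hε, hC₀, h3⟩ := h3
    have hcont : ∀ N, ContinuousOn (fun x => partialSum W g N x ω) A := fun N =>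
      continuousOn_finsetSum _ fun n _ => ((h4 n).mono hAK).mul continuousOn_const
    obtain ⟨C, hC, hscale⟩ := exists_chaining_bound hρ hTA hπT hD hπρ hπlim hcont hc
      (σ := fun x y => condParam W x y ω) h1 hε hC₀ (hβ ω) h3
    have hlim0 : Tendsto (fun k : ℕ => C * (Real.exp (-β ω * k) * (k : ℝ) ^ (η ω + 1 / 2)))
        atTop (𝓝 0) := by
      have := (tendsto_exp_mul_rpow (hβ ω) (η ω + 1 / 2)).const_mul C
      rwa [mul_zero] at this
    have hunif : UniformCauchySeqOn (fun N x => partialSum W g N x ω) atTop A :=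
      uniformCauchySeqOn_of_nets hπT h2 hlim0 (hscale.mono fun k hk => hk.1)
    have htend : TendstoUniformlyOn (fun N x => partialSum W g N x ω)
        (fun x => seriesSum W g x ω) atTop A :=
      hunif.tendstoUniformlyOn_of_tendsto fun x hx => (hunif.cauchySeq hx).tendsto_limUnder
    -- At one fixed level `k` the net is finite and each of its sequences is convergent, hence
    -- bounded; the chaining error adds a constant.
    obtain ⟨B, hB⟩ : ∃ B, ∀ x ∈ A, ∀ N, ‖partialSum W g N x ω‖ ≤ B := by
      obtain ⟨k, hk⟩ := hscale.exists
      have hp : ∀ p, ∃ B : ℝ, 0 ≤ B ∧ (p ∈ T k → ∀ N, ‖partialSum W g N p ω‖ ≤ B) := by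
        intro p
        by_cases hp : p ∈ T k
        · obtain ⟨R, hR⟩ := (h2 k p hp).norm_bddAbove
          have hR' : ∀ N, ‖partialSum W g N p ω‖ ≤ R := fun N => hR (Set.mem_range_self N)
          exact ⟨R, (norm_nonneg _).trans (hR' 0), fun _ => hR'⟩
        · exact ⟨0, le_rfl, fun h => absurd h hp⟩
      choose Bf hBf0 hBf using hp
      refine ⟨∑ p ∈ T k, Bf p + C * (Real.exp (-β ω * k) * (k : ℝ) ^ (η ω + 1 / 2)),
        fun x hx N => ?_⟩
      have e1 := hk.1 x hx N
      have e2 := hBf _ (hπT k x hx) N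
      have e3 := Finset.single_le_sum (f := Bf) (fun p _ => hBf0 p) (hπT k x hx)
      have e4 := norm_le_norm_add_norm_sub' (partialSum W g N x ω) (partialSum W g N (π k x) ω)
      linarith
    exact ⟨exists_modulus_of_scales hρ hA (F := fun N x => partialSum W g N x ω) (hβ ω) hC
      (hscale.mono fun k hk => hk.2) hB, htend, hcont⟩
  refine ⟨hall.mono fun ω h => h.1, hall.mono fun ω h => h.2.1, hall.mono fun ω h => ?_,
    hall.mono fun ω h => h.2.1.continuousOn (Frequently.of_forall h.2.2)⟩
  obtain ⟨⟨C, hC, hmod⟩, htend, -⟩ := h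
  refine ⟨C, hC, fun x hx y hy => ?_⟩
  exact le_of_tendsto' ((htend.tendsto_at hx).sub (htend.tendsto_at hy)).norm
    fun N => hmod x hx y hy N

/-- Local bounds on the conditional parameter near every point of a compact set give a bound on
the whole set at small `ρ`-distances. -/
theorem exists_forall_le_of_local {d : ℕ}
    {ρ : EuclideanSpace ℝ (Fin d) → EuclideanSpace ℝ (Fin d) → ℝ} (hρ : IsQuasiMetric ρ)
    {A : Set (EuclideanSpace ℝ (Fin d))} (hA : IsCompact A)
    {σ : EuclideanSpace ℝ (Fin d) → EuclideanSpace ℝ (Fin d) → ℝ≥0∞} {β η : ℝ}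
    (hloc : ∀ x₀ ∈ A, ∃ γ C : ℝ, 0 < γ ∧ 0 < C ∧ ∀ x ∈ Metric.closedBall x₀ γ ∩ A,
      ∀ y ∈ Metric.closedBall x₀ γ ∩ A, ρ x y ≠ 0 → ρ x y ≠ 1 →
        σ x y ≤ ENNReal.ofReal (C * ρ x y ^ β * |Real.log (ρ x y)| ^ η)) :
    ∃ ε C : ℝ, 0 < ε ∧ 0 < C ∧ ∀ x ∈ A, ∀ y ∈ A, ρ x y ≠ 0 → ρ x y < ε →
      σ x y ≤ ENNReal.ofReal (C * ρ x y ^ β * |Real.log (ρ x y)| ^ η) := by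
  -- Compactness of `A × A`: near a diagonal point the local bound applies, with `ε = 1` excluding
  -- `ρ = 1`. Near an off-diagonal point `ρ` stays above half its value there, so a small `ε` makes
  -- the claim vacuous.
  have key := (hA.prod hA).induction_on (p := fun s => ∃ ε C : ℝ, 0 < ε ∧ 0 < C ∧
    ∀ z ∈ s, z.1 ∈ A → z.2 ∈ A → ρ z.1 z.2 ≠ 0 → ρ z.1 z.2 < ε →
      σ z.1 z.2 ≤ ENNReal.ofReal (C * ρ z.1 z.2 ^ β * |Real.log (ρ z.1 z.2)| ^ η))
    ⟨1, 1, one_pos, one_pos, by simp⟩ ?_ ?_ ?_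
  · obtain ⟨ε, C, hε, hC, h⟩ := key
    exact ⟨ε, C, hε, hC, fun x hx y hy => h (x, y) ⟨hx, hy⟩ hx hy⟩
  · rintro s t hst ⟨ε, C, hε, hC, h⟩
    exact ⟨ε, C, hε, hC, fun z hz => h z (hst hz)⟩
  · rintro s t ⟨ε, C, hε, hC, h⟩ ⟨ε', C', hε', hC', h'⟩
    refine ⟨min ε ε', max C C', lt_min hε hε', lt_max_of_lt_left hC, ?_⟩
    rintro z (hz | hz) h1 h2 h3 h4 <;> have h5 := hρ.nonneg z.1 z.2
    · refine (h z hz h1 h2 h3 (h4.trans_le (min_le_left _ _))).trans (ENNReal.ofReal_le_ofReal ?_)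
      gcongr; exact le_max_left _ _
    · refine (h' z hz h1 h2 h3 (h4.trans_le (min_le_right _ _))).trans
        (ENNReal.ofReal_le_ofReal ?_)
      gcongr; exact le_max_right _ _
  · rintro ⟨x, y⟩ ⟨hx, hy⟩
    by_cases hxy : x = y
    · subst hxy
      obtain ⟨γ, C, hγ, hC, h⟩ := hloc x hx
      refine ⟨Metric.closedBall x γ ×ˢ Metric.closedBall x γ, mem_nhdsWithin_of_mem_nhds
        (prod_mem_nhds (Metric.closedBall_mem_nhds x hγ) (Metric.closedBall_mem_nhds x hγ)),
        1, C, one_pos, hC, ?_⟩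
      rintro ⟨u, v⟩ ⟨hu, hv⟩ huA hvA h0 h1
      exact h u ⟨hu, huA⟩ v ⟨hv, hvA⟩ h0 h1.ne
    · have hpos : 0 < ρ x y :=
        lt_of_le_of_ne (hρ.nonneg x y) fun h => hxy ((hρ.eq_zero_iff x y).1 h.symm)
      refine ⟨{z | ρ x y / 2 < ρ z.1 z.2}, mem_nhdsWithin_of_mem_nhds
        ((isOpen_lt continuous_const hρ.continuous).mem_nhds (half_lt_self hpos)),
        ρ x y / 2, 1, half_pos hpos, one_pos, ?_⟩
      intro z hz _ _ _ h
      exact absurd h (not_lt.2 (le_of_lt hz))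

theorem corollary3p2 {Ω : Type*} [MeasurableSpace Ω] (P : Measure Ω) [IsProbabilityMeasure P]
    (d : ℕ) (hd : 1 ≤ d) (a b : Fin d → ℝ) (hab : ∀ j, a j ≤ b j)
    (W : ℕ → EuclideanSpace ℝ (Fin d) → Ω → ℂ) (g : ℕ → Ω → ℂ)
    (hWg : CondSubGaussianSeq P (box a b) W g)
    (ρ : EuclideanSpace ℝ (Fin d) → EuclideanSpace ℝ (Fin d) → ℝ)
    (hρ : IsQuasiMetric ρ) (hρc : IsHolderComparable ρ) :
    (∀ (Ω' : Set Ω) (β η : Ω → ℝ),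
      (∀ x₀ ∈ box a b, ∃ γ C : Ω → ℝ, LocalAssumption P (box a b) W ρ x₀ Ω' γ β η C) →
      UniformRegularityOn P W g ρ (box a b) β η) ∧
    (∀ x₀ ∈ box a b, ∀ (γ : ℝ) (Ω' : Set Ω) (β η C : Ω → ℝ),
      LocalAssumption P (box a b) W ρ x₀ Ω' (fun _ => γ) β η C →
      UniformRegularityOn P W g ρ (Metric.closedBall x₀ γ ∩ box a b) β η) := by
  constructor
  · intro Ω' β η h
    -- One point of the box is needed to extract the facts about `Ω'` and `β`, which are common to
    -- all `x₀`.
    have hne : WithLp.toLp 2 a ∈ box a b := fun j => ⟨le_rfl, hab j⟩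
    obtain ⟨γ₀, C₀, h₀⟩ := h _ hne
    refine uniformRegularityOn_of_ae_condParam_le hWg hρ hρc (isCompact_box a b) subset_rfl
      (fun ω => (h₀.β_mem ω).1) ?_
    filter_upwards [(mem_ae_iff_prob_eq_one h₀.measurableSet_event).2 h₀.event_as] with ω hω
    refine exists_forall_le_of_local hρ (isCompact_box a b)
      (σ := fun x y => condParam W x y ω) fun x₀ hx₀ => ?_
    obtain ⟨γ, C, hl⟩ := h x₀ hx₀
    exact ⟨γ ω, C ω, hl.γ_pos ω, hl.C_pos ω, hl.bound ω hω⟩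
  · intro x₀ _ γ Ω' β η C h
    refine uniformRegularityOn_of_ae_condParam_le hWg hρ hρc
      ((isCompact_box a b).inter_left Metric.isClosed_closedBall) Set.inter_subset_right
      (fun ω => (h.β_mem ω).1) ?_
    filter_upwards [(mem_ae_iff_prob_eq_one h.measurableSet_event).2 h.event_as] with ω hω
    exact ⟨1, C ω, one_pos, h.C_pos ω, fun x hx y hy h0 h1 => h.bound ω hω x hx y hy h0 h1.ne⟩
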